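/- Let $g>1$ and let $\Sigma_g$ be a closed orientable surface of genus $g$ (that is, a space homeomorphic to the surface obtained from a polygon with $4g$ sides by gluing its sides in pairs according to the boundary word $a_1b_1a_1^{-1}b_1^{-1}\cdots a_gb_ga_g^{-1}b_g^{-1}$), with any base point. Then the fundamental group $\pi_1(\Sigma_g)$ admits a faithful and highly transitive action, i.e. there are an infinite countable set $X$ and a faithful action of $\pi_1(\Sigma_g)$ on $X$ such that, for every $n\ge 1$ and any two $n$-tuples $(x_1,\dots,x_n)$, $(y_1,\dots,y_n)$ of pairwise distinct points of $X$, some $\gamma\in\pi_1(\Sigma_g)$ satisfies $\gamma x_i=y_i$ for all $i$. -/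

import Mathlib

/-- A group `G` admits a faithful and highly transitive action: there are an infinite countable
set `X` and a faithful action of `G` on `X` which is `n`-transitive (transitive on ordered
`n`-tuples of pairwise distinct points) for every `n ≥ 1`. -/
def AdmitsFaithfulHighlyTransitiveAction (G : Type*) [Group G] : Prop :=
  ∃ (X : Type) (_ : Countable X) (_ : Infinite X) (_ : MulAction G X),
    FaithfulSMul G X ∧ ∀ n : ℕ, 1 ≤ n → MulAction.IsMultiplyPretransitive G X n

namespace SurfaceModel

/-- The closed unit disc, regarded as a polygon with `4 * g` sides: its sides are the arcs of the
boundary circle between consecutive `4 * g`-th roots of unity. -/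
abbrev Disc : Type := Metric.closedBall (0 : ℂ) 1

/-- The point at position `t` on the boundary of the `4 * g`-gon; the `k`-th side
(`k = 0, …, 4 * g - 1`) is traversed counterclockwise by `t ∈ [k, k + 1]`, and the integers are
the vertices. -/
noncomputable def boundaryPoint (g : ℕ) (t : ℝ) : Disc :=
  ⟨(Circle.exp (2 * Real.pi * (t / (4 * g))) : ℂ),
    mem_closedBall_zero_iff.mpr (Circle.norm_coe _).le⟩

/-- The side pairings of the `4 * g`-gon with boundary word
`a₀ b₀ a₀⁻¹ b₀⁻¹ a₁ b₁ a₁⁻¹ b₁⁻¹ ⋯`. -/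
inductive Glue (g : ℕ) : Disc → Disc → Prop
  | a (j : Fin g) (s : unitInterval) :
      Glue g (boundaryPoint g (4 * (j : ℕ) + s)) (boundaryPoint g (4 * (j : ℕ) + 3 - s))
  | b (j : Fin g) (s : unitInterval) :
      Glue g (boundaryPoint g (4 * (j : ℕ) + 1 + s)) (boundaryPoint g (4 * (j : ℕ) + 4 - s))

end SurfaceModel

/-- The standard closed orientable surface of genus `g ≥ 1`: the quotient space of the `4 * g`-gon
by the equivalence relation generated by the side pairings. (For `g = 0` nothing is glued; this
case is not used.) -/
def OrientableSurface (g : ℕ) : Type := Quot (SurfaceModel.Glue g)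

instance (g : ℕ) : TopologicalSpace (OrientableSurface g) :=
  inferInstanceAs (TopologicalSpace (Quot (SurfaceModel.Glue g)))

/-- For `g ≥ 1`, the space `S` is a closed orientable surface of genus `g`, i.e. it is homeomorphic
to the standard one. -/
def IsClosedOrientableSurfaceOfGenus (g : ℕ) (S : Type*) [TopologicalSpace S] : Prop :=
  Nonempty (S ≃ₜ OrientableSurface g)

/-! Cutting along a non-separating curve shows the surface group as an HNN extension. Let `F` be
free on `u` and on `a i`, `b i` for the other `g - 1` handles, let `v` be the surface word of those
handles times `u`, and adjoin `t` with `t u t⁻¹ = v`. Let `F` act on `F × ℕ`, freely and with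
infinitely many orbits. Any permutation `t` intertwining `u` and `v` extends this action to the HNN
extension, and a generic one makes it faithful and highly transitive (`exists_generic_perm`). Indeed
a finite partial `t` can be extended so that a given nonempty reduced word carries some point out of
its `F`-orbit (`exists_compatible_follows`). It can also be extended by `f • x i ↦ f' • y i` for
suitable `f`, `f'`, and then `f'⁻¹ t f` carries `x` to `y`. Such `f`, `f'` exist by
`separatesOrbits_prodNat`, which needs a further generator `a 0`, hence `g > 1`.

No presentation of the fundamental group is computed. It suffices that the loops crossing the sides
of the polygon generate it, that they satisfy the surface relation, and that permutations satisfying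
this relation come from a homomorphism. The HNN extension then maps onto the group, and its
injective permutation representation factors through that map. Generation holds because the quotient
is covered by open sets which deform through the polygon (`eq_top_of_crossingLoop_mem`). The
homomorphism is the monodromy of a covering glued from labelled copies of the polygon
(`GluingAtlas.exists_fundamentalGroup_hom`). -/

/-! ### Generic permutations intertwining two group elements -/

section BackAndForth

variable {F X : Type*} [Group F] [MulAction F X]

/-- A set of pairs is compatible with `u` and `v` if `u ^ k • p ↦ v ^ k • q`, for `(p, q)` in the
set, is a well-defined injective partial map. -/
def OrbitCompatible (u v : F) (S : Set (X × X)) : Prop :=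
  ∀ s ∈ S, ∀ s' ∈ S, ∀ k : ℤ, u ^ k • s.1 = s'.1 ↔ v ^ k • s.2 = s'.2

/-- Every finite set of points can be translated to points in distinct `u`-orbits, which avoid
finitely many given `u`-orbits. -/
def SeparatesOrbits (u : F) (X : Type*) [MulAction F X] : Prop :=
  ∀ A B : Finset X, ∃ f : F, (∀ a ∈ A, ∀ a' ∈ A, a ≠ a' → ∀ k : ℤ, u ^ k • f • a ≠ f • a') ∧
    ∀ a ∈ A, ∀ b ∈ B, ∀ k : ℤ, u ^ k • b ≠ f • a

theorem OrbitCompatible.union {u v : F} {S T : Set (X × X)} (hS : OrbitCompatible u v S)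
    (hT : OrbitCompatible u v T) (h₁ : ∀ s ∈ S, ∀ t ∈ T, ∀ k : ℤ, u ^ k • s.1 ≠ t.1)
    (h₂ : ∀ s ∈ S, ∀ t ∈ T, ∀ k : ℤ, v ^ k • s.2 ≠ t.2) : OrbitCompatible u v (S ∪ T) := by
  rintro s (hs | hs) s' (hs' | hs') k
  · exact hS s hs s' hs' k
  · exact iff_of_false (h₁ s hs s' hs' k) (h₂ s hs s' hs' k)
  · refine iff_of_false (fun h ↦ h₁ s' hs' s hs (-k) ?_) (fun h ↦ h₂ s' hs' s hs (-k) ?_)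
    · rw [← h, smul_smul, ← zpow_add, neg_add_cancel, zpow_zero, one_smul]
    · rw [← h, smul_smul, ← zpow_add, neg_add_cancel, zpow_zero, one_smul]
  · exact hT s hs s' hs' k

theorem OrbitCompatible.insert {u v : F} (hfree : ∀ (f : F) (x : X), f • x = x → f = 1)
    (hu : ∀ k : ℤ, u ^ k = 1 → k = 0) (hv : ∀ k : ℤ, v ^ k = 1 → k = 0)
    {S : Set (X × X)} (hS : OrbitCompatible u v S) {p q : X}
    (hp : ∀ s ∈ S, ∀ k : ℤ, u ^ k • s.1 ≠ p) (hq : ∀ s ∈ S, ∀ k : ℤ, v ^ k • s.2 ≠ q) :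
    OrbitCompatible u v (insert (p, q) S) := by
  rw [Set.insert_eq, Set.union_comm]
  refine hS.union ?_ (by rintro s hs _ rfl; exact hp s hs) (by rintro s hs _ rfl; exact hq s hs)
  rintro _ rfl _ rfl k
  constructor
  · intro h; simp [hu k (hfree _ _ h)]
  · intro h; simp [hv k (hfree _ _ h)]

/-- Extend equivariantly by `u ^ k • p ↦ v ^ k • q`. Compatibility makes this relation single-valued
in both directions, and meeting every orbit makes it total in both directions. -/
theorem OrbitCompatible.exists_perm {u v : F} {S : Set (X × X)} (hS : OrbitCompatible u v S)
    (h₁ : ∀ p, ∃ s ∈ S, ∃ k : ℤ, u ^ k • s.1 = p) (h₂ : ∀ q, ∃ s ∈ S, ∃ k : ℤ, v ^ k • s.2 = q) :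
    ∃ t : Equiv.Perm X, (∀ s ∈ S, t s.1 = s.2) ∧ ∀ p, t (u • p) = v • t p := by
  set r : X → X → Prop := fun p q ↦ ∃ s ∈ S, ∃ k : ℤ, u ^ k • s.1 = p ∧ v ^ k • s.2 = q with hr
  have key : ∀ s ∈ S, ∀ s' ∈ S, ∀ k k' : ℤ, u ^ k • s.1 = u ^ k' • s'.1 ↔
      v ^ k • s.2 = v ^ k' • s'.2 := by
    intro s hs s' hs' k k'
    have := hS s hs s' hs' (-k' + k)
    rwa [zpow_add, zpow_add, mul_smul, mul_smul, zpow_neg, zpow_neg, inv_smul_eq_iff,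
      inv_smul_eq_iff] at this
  have hr₁ : ∀ p q q', r p q → r p q' → q = q' := by
    rintro _ _ _ ⟨s, hs, k, rfl, rfl⟩ ⟨s', hs', k', h, rfl⟩
    exact (key s hs s' hs' k k').1 h.symm
  have hr₂ : ∀ p p' q, r p q → r p' q → p = p' := by
    rintro _ _ _ ⟨s, hs, k, rfl, rfl⟩ ⟨s', hs', k', rfl, h⟩
    exact (key s hs s' hs' k k').2 h.symm
  have e₁ : ∀ p, ∃ q, r p q := fun p ↦ by
    obtain ⟨s, hs, k, h⟩ := h₁ p
    exact ⟨_, s, hs, k, h, rfl⟩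
  have e₂ : ∀ q, ∃ p, r p q := fun q ↦ by
    obtain ⟨s, hs, k, h⟩ := h₂ q
    exact ⟨_, s, hs, k, rfl, h⟩
  choose f hf using e₁
  choose g hg using e₂
  refine ⟨⟨f, g, fun p ↦ hr₂ _ _ _ (hg _) (hf _), fun q ↦ hr₁ _ _ _ (hf _) (hg _)⟩, ?_, ?_⟩
  · exact fun s hs ↦ hr₁ _ _ _ (hf _) ⟨s, hs, 0, by simp, by simp⟩
  · intro p
    obtain ⟨s, hs, k, h, h'⟩ := hf p
    refine hr₁ _ _ _ (hf _) ⟨s, hs, 1 + k, ?_, ?_⟩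
    · rw [zpow_add, mul_smul, h, zpow_one]
    · rw [zpow_add, mul_smul, h', zpow_one]; rfl

/-- `Follows S l p q` means that the word `l` in the letters `t ^ (±1) * g` moves `p` to `q`, where
only the values of `t` prescribed by `S` are used. -/
def Follows (S : Set (X × X)) : List (ℤˣ × F) → X → X → Prop
  | [], p, q => p = q
  | (e, g) :: l, p, q => ∃ q', Follows S l p q' ∧
      if e = 1 then (g • q', q) ∈ S else (q, g • q') ∈ S

theorem Follows.mono {S T : Set (X × X)} (h : S ⊆ T) :
    ∀ {l : List (ℤˣ × F)} {p q : X}, Follows S l p q → Follows T l p q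
  | [], _, _, hl => hl
  | (e, g) :: l, p, q, ⟨q', h₁, h₂⟩ => by
    refine ⟨q', h₁.mono h, ?_⟩
    split_ifs at h₂ ⊢
    exacts [h h₂, h h₂]

theorem Follows.prod_apply {S : Set (X × X)} {G : Type*} [Group G] (α : G →* Equiv.Perm X)
    (of : F →* G) (t : G) (hof : ∀ f x, α (of f) x = f • x) (ht : ∀ s ∈ S, α t s.1 = s.2) :
    ∀ {l : List (ℤˣ × F)} {p q : X}, Follows S l p q →
      α (l.map fun x ↦ t ^ (x.1 : ℤ) * of x.2).prod p = q
  | [], p, _, h => by simpa using (show p = _ from h)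
  | (e, g) :: l, p, q, ⟨q', h₁, h₂⟩ => by
    rw [List.map_cons, List.prod_cons, map_mul, Equiv.Perm.mul_apply,
      h₁.prod_apply α of t hof ht, map_mul, Equiv.Perm.mul_apply, hof]
    rcases Int.units_eq_one_or e with rfl | rfl
    · simpa using ht _ (by simpa using h₂)
    · have : α t q = g • q' := ht _ (by simpa using h₂)
      simp [← this]

/-- The component of a pair on which `t ^ e` acts. -/
def sideOf (e : ℤˣ) (s : X × X) : X := if e = 1 then s.1 else s.2

/-- Read the word from its last letter, sending each new point into a fresh `F`-orbit. The clause
about `l.head?` is the induction invariant: the orbit of the current point `q` misses the side read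
by the latest letter and meets the other side at most in `q`. The next letter could thus meet a
known value only by undoing the latest one, which reducedness forbids. -/
theorem exists_compatible_follows {u v : F} (hfree : ∀ (f : F) (x : X), f • x = x → f = 1)
    (hfresh : ∀ T : Finset X, ∃ x : X, ∀ y ∈ T, ∀ f : F, f • y ≠ x)
    (hu : ∀ k : ℤ, u ^ k = 1 → k = 0) (hv : ∀ k : ℤ, v ^ k = 1 → k = 0)
    (S : Finset (X × X)) (hS : OrbitCompatible u v (S : Set (X × X))) (p : X)
    (hp : ∀ s ∈ S, ∀ f : F, f • s.1 ≠ p ∧ f • s.2 ≠ p) (l : List (ℤˣ × F))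
    (hl : l.IsChain (fun a b ↦
      a.2 ∈ HNNExtension.toSubgroup (Subgroup.zpowers u) (Subgroup.zpowers v) a.1 → a.1 = b.1)) :
    ∃ S' : Finset (X × X), S ⊆ S' ∧ OrbitCompatible u v (S' : Set (X × X)) ∧
      ∃ q, Follows (S' : Set (X × X)) l p q ∧ (l = [] → S' = S ∧ q = p) ∧
        ∀ x ∈ l.head?, (∀ f : F, f • p ≠ q) ∧ ∀ s ∈ S', (∀ f : F, f • q ≠ sideOf x.1 s) ∧
          ∀ f : F, f • q = sideOf (-x.1) s → sideOf (-x.1) s = q := by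
  classical
  have hinv : ∀ {f : F} {x y : X}, f • x = y → x = f⁻¹ • y := fun h ↦ eq_inv_smul_iff.2 h
  induction l with
  | nil => exact ⟨S, subset_rfl, hS, p, rfl, by simp, by simp⟩
  | cons a l ih =>
    obtain ⟨e, g⟩ := a
    obtain ⟨S', hSS', hS', q, hq, hnil, hhead⟩ := ih hl.tail
    obtain ⟨q', hq'⟩ := hfresh ((S'.image Prod.fst ∪ S'.image Prod.snd) ∪ {p, q})
    have f₁ : ∀ s ∈ S', ∀ f : F, f • s.1 ≠ q' := fun s hs ↦ hq' _ (by
      simp only [Finset.mem_union, Finset.mem_image]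
      exact Or.inl (Or.inl ⟨s, hs, rfl⟩))
    have f₂ : ∀ s ∈ S', ∀ f : F, f • s.2 ≠ q' := fun s hs ↦ hq' _ (by
      simp only [Finset.mem_union, Finset.mem_image]
      exact Or.inl (Or.inr ⟨s, hs, rfl⟩))
    have f₃ : ∀ f : F, f • p ≠ q' := hq' _ (by simp)
    have f₄ : ∀ f : F, f • q ≠ q' := hq' _ (by simp)
    -- The pairs in `S'` do not yet determine `t ^ e` at `g • q`, so its value there may be chosen
    -- freely.
    have key : ∀ s ∈ S', ∀ k : ℤ,
        (if e = 1 then u else v) ^ k • sideOf e s ≠ g • q := by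
      intro s hs k h
      cases l with
      | nil =>
        obtain ⟨rfl, rfl⟩ := hnil rfl
        have := hp s hs (g⁻¹ * (if e = 1 then u else v) ^ k)
        rw [mul_smul, mul_smul] at this
        unfold sideOf at h
        split_ifs at h this
        · exact this.1 (by rw [h, inv_smul_smul])
        · exact this.2 (by rw [h, inv_smul_smul])
      | cons b l =>
        obtain ⟨-, hb⟩ := hhead b (by simp)
        have h' : ((if e = 1 then u else v) ^ (-k) * g) • q = sideOf e s := by
          rw [mul_smul, ← h, smul_smul, ← zpow_add, neg_add_cancel, zpow_zero, one_smul]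
        rcases eq_or_ne e b.1 with he | he
        · exact (hb s hs).1 _ (he ▸ h')
        -- The exponents are opposite, so the side now read meets the orbit of `q` only in `q`. By
        -- freeness `g` is a power of `u` or `v`, and the word would not be reduced.
        · have he' : e = -b.1 := Int.units_ne_iff_eq_neg.1 he
          have h1 := (hb s hs).2 _ (he' ▸ h')
          rw [← he'] at h1
          rw [h1] at h'
          have h2 := hfree _ _ h'
          refine he ((List.isChain_cons_cons.1 hl).1 ?_)
          have h3 : g = (if e = 1 then u else v) ^ k := by
            rw [zpow_neg] at h2; exact (inv_mul_eq_one.1 h2).symm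
          rcases Int.units_eq_one_or e with h4 | h4
          · subst h4; exact ⟨k, by simpa using h3.symm⟩
          · subst h4; exact ⟨k, by simpa using h3.symm⟩
    rcases Int.units_eq_one_or e with rfl | rfl
    · refine ⟨insert (g • q, q') S', hSS'.trans (Finset.subset_insert _ _), ?_, q',
        ⟨q, hq.mono (by simp), by simp⟩, by simp, ?_⟩
      · rw [Finset.coe_insert]
        exact hS'.insert hfree hu hv (by simpa [sideOf] using key) fun s hs k ↦ f₂ s hs _
      · rintro x hx
        obtain rfl : (1, g) = x := by simpa using hx
        refine ⟨f₃, fun s hs ↦ ?_⟩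
        rcases Finset.mem_insert.1 hs with rfl | hs
        · refine ⟨fun f h ↦ f₄ (f⁻¹ * g) ?_, fun f _ ↦ by simp [sideOf]⟩
          rw [mul_smul]; exact (hinv h).symm
        · exact ⟨fun f h ↦ f₁ s hs f⁻¹ (hinv h).symm, fun f h ↦ (f₂ s hs f⁻¹ (hinv h).symm).elim⟩
    · refine ⟨insert (q', g • q) S', hSS'.trans (Finset.subset_insert _ _), ?_, q',
        ⟨q, hq.mono (by simp), by simp⟩, by simp, ?_⟩
      · rw [Finset.coe_insert]
        exact hS'.insert hfree hu hv (fun s hs k ↦ f₁ s hs _) (by simpa [sideOf] using key)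
      · rintro x hx
        obtain rfl : (-1, g) = x := by simpa using hx
        refine ⟨f₃, fun s hs ↦ ?_⟩
        rcases Finset.mem_insert.1 hs with rfl | hs
        · refine ⟨fun f h ↦ f₄ (f⁻¹ * g) ?_, fun f _ ↦ by simp [sideOf]⟩
          rw [mul_smul]; exact (hinv h).symm
        · exact ⟨fun f h ↦ f₂ s hs f⁻¹ (hinv h).symm, fun f h ↦ (f₁ s hs f⁻¹ (hinv h).symm).elim⟩

/-- Finite compatible sets of pairs, ordered by inclusion. -/
abbrev FiniteCompatible (u v : F) (X : Type*) [MulAction F X] : Type _ :=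
  {S : Finset (X × X) // OrbitCompatible u v (S : Set (X × X))}

/-- Each requirement (a point in the domain, a point in the range, a pair of tuples, a reduced word)
is cofinal among finite compatible sets, and there are countably many. The Rasiowa–Sikorski lemma
gives an ideal meeting them all, whose union is the graph sought, up to translation by powers of `u`
and `v`. -/
theorem exists_generic_perm [Countable F] [Countable X] {u v : F}
    (hfree : ∀ (f : F) (x : X), f • x = x → f = 1)
    (hfresh : ∀ T : Finset X, ∃ x : X, ∀ y ∈ T, ∀ f : F, f • y ≠ x)
    (hu : ∀ k : ℤ, u ^ k = 1 → k = 0) (hv : ∀ k : ℤ, v ^ k = 1 → k = 0)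
    (hsu : SeparatesOrbits u X) (hsv : SeparatesOrbits v X) :
    ∃ (S : Set (X × X)) (t : Equiv.Perm X), (∀ s ∈ S, t s.1 = s.2) ∧
      (∀ p, t (u • p) = v • t p) ∧
      (∀ (n : ℕ) (x y : Fin n ↪ X), ∃ f f' : F, ∀ i, (f • x i, f' • y i) ∈ S) ∧
      ∀ l : List (ℤˣ × F), l ≠ [] → l.IsChain (fun a b ↦
          a.2 ∈ HNNExtension.toSubgroup (Subgroup.zpowers u) (Subgroup.zpowers v) a.1 →
            a.1 = b.1) →
        ∃ p q, Follows S l p q ∧ ∀ f : F, f • p ≠ q := by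
  classical
  have hdom : ∀ p : X, IsCofinal {S : FiniteCompatible u v X |
      ∃ s ∈ S.1, ∃ k : ℤ, u ^ k • s.1 = p} := by
    rintro p ⟨S, hS⟩
    by_cases h : ∃ s ∈ S, ∃ k : ℤ, u ^ k • s.1 = p
    · exact ⟨⟨S, hS⟩, h, le_rfl⟩
    · push Not at h
      obtain ⟨q, hq⟩ := hfresh (S.image Prod.snd)
      refine ⟨⟨insert (p, q) S, ?_⟩, ⟨(p, q), by simp, 0, by simp⟩, Finset.subset_insert _ _⟩
      rw [Finset.coe_insert]
      exact hS.insert hfree hu hv h fun s hs k ↦ hq _ (Finset.mem_image_of_mem _ hs) _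
  have hran : ∀ q : X, IsCofinal {S : FiniteCompatible u v X |
      ∃ s ∈ S.1, ∃ k : ℤ, v ^ k • s.2 = q} := by
    rintro q ⟨S, hS⟩
    by_cases h : ∃ s ∈ S, ∃ k : ℤ, v ^ k • s.2 = q
    · exact ⟨⟨S, hS⟩, h, le_rfl⟩
    · push Not at h
      obtain ⟨p, hp⟩ := hfresh (S.image Prod.fst)
      refine ⟨⟨insert (p, q) S, ?_⟩, ⟨(p, q), by simp, 0, by simp⟩, Finset.subset_insert _ _⟩
      rw [Finset.coe_insert]
      exact hS.insert hfree hu hv (fun s hs k ↦ hp _ (Finset.mem_image_of_mem _ hs) _) h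
  have htup : ∀ m : (n : ℕ) × (Fin n ↪ X) × (Fin n ↪ X), IsCofinal {S : FiniteCompatible u v X |
      ∃ f f' : F, ∀ i, (f • m.2.1 i, f' • m.2.2 i) ∈ S.1} := by
    rintro ⟨n, x, y⟩ ⟨S, hS⟩
    obtain ⟨f, hf₁, hf₂⟩ := hsu (Finset.univ.image x) (S.image Prod.fst)
    obtain ⟨f', hf'₁, hf'₂⟩ := hsv (Finset.univ.image y) (S.image Prod.snd)
    refine ⟨⟨S ∪ Finset.univ.image fun i ↦ (f • x i, f' • y i), ?_⟩, ⟨f, f', fun i ↦ ?_⟩,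
      Finset.subset_union_left⟩
    · rw [Finset.coe_union]
      refine hS.union ?_ ?_ ?_
      · simp only [Finset.coe_image, Finset.coe_univ, Set.image_univ]
        rintro _ ⟨i, rfl⟩ _ ⟨j, rfl⟩ k
        rcases eq_or_ne i j with rfl | hij
        · constructor
          · intro h; simp [hu k (hfree _ _ h)]
          · intro h; simp [hv k (hfree _ _ h)]
        · exact iff_of_false (hf₁ _ (by simp) _ (by simp) (x.injective.ne hij) k)
            (hf'₁ _ (by simp) _ (by simp) (y.injective.ne hij) k)
      · simp only [Finset.coe_image, Finset.coe_univ, Set.image_univ]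
        rintro s hs _ ⟨i, rfl⟩ k
        exact hf₂ _ (by simp) _ (Finset.mem_image_of_mem _ hs) k
      · simp only [Finset.coe_image, Finset.coe_univ, Set.image_univ]
        rintro s hs _ ⟨i, rfl⟩ k
        exact hf'₂ _ (by simp) _ (Finset.mem_image_of_mem _ hs) k
    · exact Finset.mem_union_right _ (Finset.mem_image_of_mem _ (Finset.mem_univ i))
  have hword : ∀ l : {l : List (ℤˣ × F) // l ≠ [] ∧ l.IsChain (fun a b ↦
      a.2 ∈ HNNExtension.toSubgroup (Subgroup.zpowers u) (Subgroup.zpowers v) a.1 →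
        a.1 = b.1)}, IsCofinal {S : FiniteCompatible u v X |
      ∃ p q, Follows (S.1 : Set (X × X)) l.1 p q ∧ ∀ f : F, f • p ≠ q} := by
    rintro ⟨l, hne, hl⟩ ⟨S, hS⟩
    obtain ⟨p, hp⟩ := hfresh (S.image Prod.fst ∪ S.image Prod.snd)
    obtain ⟨S', h₁, h₂, q, h₃, -, h₄⟩ := exists_compatible_follows hfree hfresh hu hv S hS p
      (fun s hs f ↦ ⟨hp _ (Finset.mem_union_left _ (Finset.mem_image_of_mem _ hs)) f,
        hp _ (Finset.mem_union_right _ (Finset.mem_image_of_mem _ hs)) f⟩) l hl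
    obtain ⟨a, l, rfl⟩ := List.exists_cons_of_ne_nil hne
    exact ⟨⟨S', h₂⟩, ⟨p, q, h₃, (h₄ a (by simp)).1⟩, h₁⟩
  have : Encodable ((X ⊕ X) ⊕ (((n : ℕ) × (Fin n ↪ X) × (Fin n ↪ X)) ⊕
      {l : List (ℤˣ × F) // l ≠ [] ∧ l.IsChain (fun a b ↦
        a.2 ∈ HNNExtension.toSubgroup (Subgroup.zpowers u) (Subgroup.zpowers v) a.1 →
          a.1 = b.1)})) := by
    have : ∀ n : ℕ, Countable (Fin n ↪ X) := fun n ↦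
      Function.Injective.countable (f := fun x : Fin n ↪ X ↦ (x : Fin n → X))
        DFunLike.coe_injective
    exact Encodable.ofCountable _
  let I := Order.idealOfCofinals (P := FiniteCompatible u v X)
    ⟨∅, by intro s hs; simp at hs⟩
    (Sum.elim (Sum.elim (fun p ↦ ⟨_, hdom p⟩) fun q ↦ ⟨_, hran q⟩)
      (Sum.elim (fun m ↦ ⟨_, htup m⟩) fun l ↦ ⟨_, hword l⟩))
  have hI := Order.cofinal_meets_idealOfCofinals (P := FiniteCompatible u v X)
    ⟨∅, by intro s hs; simp at hs⟩
    (Sum.elim (Sum.elim (fun p ↦ ⟨_, hdom p⟩) fun q ↦ ⟨_, hran q⟩)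
      (Sum.elim (fun m ↦ ⟨_, htup m⟩) fun l ↦ ⟨_, hword l⟩))
  set U : Set (X × X) := {s | ∃ S ∈ I, s ∈ S.1} with hU
  have hsub : ∀ S ∈ I, (S.1 : Set (X × X)) ⊆ U := fun S hS s hs ↦ ⟨S, hS, hs⟩
  -- Compatibility involves two pairs at a time, and directedness puts both in one member of the
  -- ideal.
  have hcomp : OrbitCompatible u v U := by
    rintro s ⟨S, hS, hs⟩ s' ⟨S', hS', hs'⟩
    obtain ⟨T, -, h₁, h₂⟩ := I.directed S hS S' hS'
    exact T.2 s (h₁ hs) s' (h₂ hs')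
  obtain ⟨t, ht, ht'⟩ := hcomp.exists_perm
    (fun p ↦ by
      obtain ⟨S, ⟨s, hs, h⟩, hSI⟩ := hI (Sum.inl (Sum.inl p))
      exact ⟨s, ⟨S, hSI, hs⟩, h⟩)
    (fun q ↦ by
      obtain ⟨S, ⟨s, hs, h⟩, hSI⟩ := hI (Sum.inl (Sum.inr q))
      exact ⟨s, ⟨S, hSI, hs⟩, h⟩)
  refine ⟨U, t, ht, ht', fun n x y ↦ ?_, fun l hne hl ↦ ?_⟩
  · obtain ⟨S, ⟨f, f', h⟩, hSI⟩ := hI (Sum.inr (Sum.inl ⟨n, x, y⟩))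
    exact ⟨f, f', fun i ↦ ⟨S, hSI, h i⟩⟩
  · obtain ⟨S, ⟨p, q, h, h'⟩, hSI⟩ := hI (Sum.inr (Sum.inr ⟨l, hne, hl⟩))
    exact ⟨p, q, h.mono (hsub S hSI), h'⟩

end BackAndForth

/-! ### Separating orbits, and permutation representations of HNN extensions -/

section Separation

/-- The action of `ℤ` on `ℤ × ℤ` by translations of the column over `0`. -/
def columnShift : Multiplicative ℤ →* Equiv.Perm (ℤ × ℤ) where
  toFun k :=
    { toFun := fun p ↦ (p.1, p.2 + if p.1 = 0 then k.toAdd else 0)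
      invFun := fun p ↦ (p.1, p.2 - if p.1 = 0 then k.toAdd else 0)
      left_inv := fun p ↦ by simp
      right_inv := fun p ↦ by simp }
  map_one' := by ext p <;> simp
  map_mul' k l := by
    ext p
    · simp
    · by_cases h : p.1 = 0 <;> simp [h]; ring

/-- The action of `ℤ` on `ℤ × ℤ` by translations of the first coordinate. -/
def rowShift : Multiplicative ℤ →* Equiv.Perm (ℤ × ℤ) where
  toFun k :=
    { toFun := fun p ↦ (p.1 + k.toAdd, p.2)
      invFun := fun p ↦ (p.1 - k.toAdd, p.2)
      left_inv := fun p ↦ by simp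
      right_inv := fun p ↦ by simp }
  map_one' := by ext p <;> simp
  map_mul' k l := by
    ext p
    · simp; ring
    · simp

theorem columnShift_zpow_apply (k : ℤ) (p : ℤ × ℤ) :
    (columnShift (.ofAdd 1) ^ k) p = (p.1, p.2 + if p.1 = 0 then k else 0) := by
  rw [← map_zpow, ← ofAdd_zsmul]; simp [columnShift]

theorem rowShift_zpow_apply (k : ℤ) (p : ℤ × ℤ) :
    (rowShift (.ofAdd 1) ^ k) p = (p.1 + k, p.2) := by
  rw [← map_zpow, ← ofAdd_zsmul]; simp [rowShift]

theorem eq_zero_of_columnShift_zpow_eq_one {k : ℤ} (h : columnShift (.ofAdd 1) ^ k = 1) :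
    k = 0 := by
  have := congr_arg (fun σ : Equiv.Perm (ℤ × ℤ) ↦ (σ (0, 0)).2) h
  simpa [columnShift_zpow_apply] using this

theorem eq_zero_of_rowShift_zpow_eq_columnShift_zpow {n k : ℤ}
    (h : rowShift (.ofAdd 1) ^ n = columnShift (.ofAdd 1) ^ k) : n = 0 := by
  have := congr_arg (fun σ : Equiv.Perm (ℤ × ℤ) ↦ (σ (0, 0)).1) h
  simpa [columnShift_zpow_apply, rowShift_zpow_apply] using this

/-- At `(0, 0)` the left side gives `(n, m)`. On the right, if `n ≠ 0`, the row shift leaves the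
column over `0` first, so the result is `(n, 0)`. -/
theorem eq_zero_of_conj_columnShift_zpow {n m k : ℤ} (hm : m ≠ 0)
    (h : rowShift (.ofAdd 1) ^ n * columnShift (.ofAdd 1) ^ m =
      columnShift (.ofAdd 1) ^ k * rowShift (.ofAdd 1) ^ n) : n = 0 := by
  by_contra hn
  have := congr_arg (fun σ : Equiv.Perm (ℤ × ℤ) ↦ (σ (0, 0)).2) h
  simp [columnShift_zpow_apply, rowShift_zpow_apply, hn] at this
  exact hm this

variable {F : Type*} [Group F]

/-- The action of a group on countably many copies of itself by left multiplication. -/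
abbrev prodNatMulAction (F : Type*) [Group F] : MulAction F (F × ℕ) where
  smul f x := (f * x.1, x.2)
  one_smul _ := Prod.ext (one_mul _) rfl
  mul_smul _ _ _ := Prod.ext (mul_assoc _ _ _) rfl

/-- Translate by a power `z ^ n`. Each of the finitely many coincidences to be avoided occurs for at
most one `n`, as the images of `u` and `z` under `θ` show. -/
theorem separatesOrbits_prodNat {u z : F} (θ : F →* Equiv.Perm (ℤ × ℤ))
    (hu : θ u = columnShift (.ofAdd 1)) (hz : θ z = rowShift (.ofAdd 1)) :
    letI := prodNatMulAction F
    SeparatesOrbits u (F × ℕ) := by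
  let := prodNatMulAction F
  have hsmul : ∀ (f : F) (x : F × ℕ), f • x = (f * x.1, x.2) := fun _ _ ↦ rfl
  intro A B
  classical
  have fin₁ : ∀ a a' : F × ℕ, a ≠ a' →
      {n : ℤ | ∃ k : ℤ, u ^ k • z ^ n • a = z ^ n • a'}.Subsingleton := by
    rintro ⟨a, i⟩ ⟨a', j⟩ hne n ⟨k, hk⟩ m ⟨l, hl⟩
    simp only [hsmul, Prod.mk.injEq] at hk hl
    obtain ⟨hk, rfl⟩ := hk
    have hne : a ≠ a' := fun h ↦ hne (by rw [h])
    -- Both conjugates equal `a' * a⁻¹`, so `z ^ (m - n)` conjugates `u ^ k` to `u ^ l`.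
    have hc : z ^ (-n) * u ^ k * z ^ n = z ^ (-m) * u ^ l * z ^ m := by
      have h1 : z ^ (-n) * u ^ k * z ^ n = a' * a⁻¹ := by
        rw [eq_mul_inv_iff_mul_eq, mul_assoc, mul_assoc, hk, zpow_neg, inv_mul_cancel_left]
      have h2 : z ^ (-m) * u ^ l * z ^ m = a' * a⁻¹ := by
        rw [eq_mul_inv_iff_mul_eq, mul_assoc, mul_assoc, hl.1, zpow_neg, inv_mul_cancel_left]
      rw [h1, h2]
    have hk0 : k ≠ 0 := by
      rintro rfl
      exact hne (by simpa using hk)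
    have : m - n = 0 := by
      refine eq_zero_of_conj_columnShift_zpow (k := l) hk0 ?_
      rw [← hu, ← hz, ← map_zpow, ← map_zpow, ← map_zpow, ← map_mul, ← map_mul]
      congr 1
      calc z ^ (m - n) * u ^ k = z ^ m * (z ^ (-n) * u ^ k * z ^ n) * z ^ (-n) := by group
        _ = u ^ l * z ^ (m - n) := by rw [hc]; group
    omega
  have fin₂ : ∀ a b : F × ℕ, {n : ℤ | ∃ k : ℤ, u ^ k • b = z ^ n • a}.Subsingleton := by
    rintro ⟨a, i⟩ ⟨b, j⟩ n ⟨k, hk⟩ m ⟨l, hl⟩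
    simp only [hsmul, Prod.mk.injEq] at hk hl
    have : n - m = 0 := by
      refine eq_zero_of_rowShift_zpow_eq_columnShift_zpow (k := k - l) ?_
      rw [← hu, ← hz, ← map_zpow, ← map_zpow]
      congr 1
      have h1 : z ^ n = u ^ k * b * a⁻¹ := by rw [hk.1]; group
      have h2 : z ^ m = u ^ l * b * a⁻¹ := by rw [hl.1]; group
      rw [zpow_sub, h1, h2]; group
    omega
  have hfin : (⋃ a ∈ A, ⋃ a' ∈ A.filter (a ≠ ·),
        {n : ℤ | ∃ k : ℤ, u ^ k • z ^ n • a = z ^ n • a'}) ∪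
      (⋃ a ∈ A, ⋃ b ∈ B, {n : ℤ | ∃ k : ℤ, u ^ k • b = z ^ n • a}) |>.Finite := by
    refine Set.Finite.union ?_ ?_
    · exact A.finite_toSet.biUnion fun a _ ↦ (Finset.finite_toSet _).biUnion fun a' ha' ↦
        (fin₁ a a' (Finset.mem_filter.1 ha').2).finite
    · exact A.finite_toSet.biUnion fun a _ ↦ B.finite_toSet.biUnion fun b _ ↦
        (fin₂ a b).finite
  obtain ⟨n, hn⟩ := hfin.exists_notMem
  simp only [Set.mem_union, Set.mem_iUnion, Set.mem_ofPred_eq, Finset.mem_filter, not_or,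
    not_exists] at hn
  exact ⟨z ^ n, fun a ha a' ha' hne k ↦ hn.1 a ha a' ⟨ha', hne⟩ k,
    fun a ha b hb k ↦ hn.2 a ha b hb k⟩

theorem exists_zpowers_mulEquiv {u v : F} (hu : ∀ k : ℤ, u ^ k = 1 → k = 0)
    (hv : ∀ k : ℤ, v ^ k = 1 → k = 0) :
    ∃ φ : Subgroup.zpowers u ≃* Subgroup.zpowers v, (φ ⟨u, Subgroup.mem_zpowers u⟩ : F) = v := by
  have key : ∀ w : F, (∀ k : ℤ, w ^ k = 1 → k = 0) →
      ∃ ψ : Multiplicative ℤ ≃* Subgroup.zpowers w, ψ (.ofAdd 1) = w := by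
    intro w hw
    have hinj : Function.Injective (zpowersHom F w) := by
      rw [injective_iff_map_eq_one]
      intro k hk
      have := hw k.toAdd (by simpa using hk)
      exact this
    have hrange : (zpowersHom F w).range = Subgroup.zpowers w := by
      ext x
      simp [Subgroup.mem_zpowers_iff]
    exact ⟨(MonoidHom.ofInjective hinj).trans (MulEquiv.subgroupCongr hrange), zpow_one w⟩
  obtain ⟨ψ, hψ⟩ := key u hu
  obtain ⟨χ, hχ⟩ := key v hv
  refine ⟨ψ.symm.trans χ, ?_⟩
  have : ψ.symm ⟨u, Subgroup.mem_zpowers u⟩ = .ofAdd 1 := by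
    rw [MulEquiv.symm_apply_eq]; exact Subtype.ext hψ.symm
  rw [MulEquiv.trans_apply, this, hχ]

theorem mul_map_eq_of_generator {u v : F} {φ : Subgroup.zpowers u ≃* Subgroup.zpowers v}
    (hφ : (φ ⟨u, Subgroup.mem_zpowers u⟩ : F) = v) {G : Type*} [Group G] (f : F →* G) (t : G)
    (ht : t * f u = f v * t) (a : Subgroup.zpowers u) : t * f a = f (φ a) * t := by
  obtain ⟨_, k, rfl⟩ := a
  have h1 : (⟨u ^ k, k, rfl⟩ : Subgroup.zpowers u) = ⟨u, Subgroup.mem_zpowers u⟩ ^ k :=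
    Subtype.ext (by simp)
  have h2 : (φ ⟨u ^ k, k, rfl⟩ : F) = v ^ k := by
    rw [h1, map_zpow, Subgroup.coe_zpow, hφ]
  have h3 : SemiconjBy t (f u) (f v) := ht
  change t * f (u ^ k) = f (φ ⟨u ^ k, k, rfl⟩) * t
  rw [h2, map_zpow, map_zpow]
  exact (h3.zpow_right k).eq

/-- Only the existence of reduced forms is used, not their uniqueness: if the word part carries `p`
out of its `F`-orbit, no head in `F` can bring it back to `p`. -/
theorem HNNExtension.exists_injective_perm_hom [Countable F] {u v z : F}
    (θ : F →* Equiv.Perm (ℤ × ℤ)) (hu : θ u = columnShift (.ofAdd 1))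
    (hv : θ v = columnShift (.ofAdd 1)) (hz : θ z = rowShift (.ofAdd 1))
    (φ : Subgroup.zpowers u ≃* Subgroup.zpowers v)
    (hφ : (φ ⟨u, Subgroup.mem_zpowers u⟩ : F) = v) :
    ∃ α : HNNExtension F (Subgroup.zpowers u) (Subgroup.zpowers v) φ →* Equiv.Perm (F × ℕ),
      Function.Injective α ∧
        ∀ (n : ℕ) (x y : Fin n ↪ F × ℕ), ∃ g, ∀ i, α g (x i) = y i := by
  let := prodNatMulAction F
  have hsmul : ∀ (f : F) (x : F × ℕ), f • x = (f * x.1, x.2) := fun _ _ ↦ rfl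
  have hord : ∀ w : F, θ w = columnShift (.ofAdd 1) → ∀ k : ℤ, w ^ k = 1 → k = 0 := by
    intro w hw k hk
    refine eq_zero_of_columnShift_zpow_eq_one ?_
    rw [← hw, ← map_zpow, hk, map_one]
  have hfree : ∀ (f : F) (x : F × ℕ), f • x = x → f = 1 := by
    rintro f ⟨a, i⟩ h
    simpa [hsmul] using h
  have hfresh : ∀ T : Finset (F × ℕ), ∃ x : F × ℕ, ∀ y ∈ T, ∀ f : F, f • y ≠ x := by
    intro T
    obtain ⟨m, hm⟩ := Infinite.exists_notMem_finset (T.image Prod.snd)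
    refine ⟨(1, m), fun y hy f h ↦ hm ?_⟩
    rw [hsmul, Prod.mk.injEq] at h
    exact h.2 ▸ Finset.mem_image_of_mem _ hy
  obtain ⟨S, t, hS, ht, htup, hword⟩ := exists_generic_perm hfree hfresh (hord u hu) (hord v hv)
    (separatesOrbits_prodNat θ hu hz) (separatesOrbits_prodNat θ hv hz)
  have hrel := mul_map_eq_of_generator hφ (MulAction.toPermHom F (F × ℕ)) t
    (Equiv.ext fun p ↦ ht p)
  set α := HNNExtension.lift (φ := φ) (MulAction.toPermHom F (F × ℕ)) t hrel with hα
  have hof : ∀ f x, α (HNNExtension.of f) x = f • x := by simp [hα]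
  have hαt : ∀ s ∈ S, α HNNExtension.t s.1 = s.2 := by simpa [hα] using hS
  refine ⟨α, ?_, fun n x y ↦ ?_⟩
  · rw [injective_iff_map_eq_one]
    intro g hg
    let d := Classical.arbitrary
      (HNNExtension.NormalWord.TransversalPair F (Subgroup.zpowers u) (Subgroup.zpowers v))
    obtain ⟨w, rfl⟩ := (HNNExtension.NormalWord.equiv φ d).symm.surjective g
    change α (HNNExtension.of w.head *
      (w.toList.map fun x ↦ HNNExtension.t ^ (x.1 : ℤ) * HNNExtension.of x.2).prod) = 1 at hg
    change HNNExtension.of w.head *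
      (w.toList.map fun x ↦ HNNExtension.t ^ (x.1 : ℤ) * HNNExtension.of x.2).prod = 1
    by_cases hnil : w.toList = []
    · rw [hnil, List.map_nil, List.prod_nil, mul_one] at hg ⊢
      rw [hfree w.head (1, 0) (by rw [← hof, hg]; rfl), map_one]
    · obtain ⟨p, q, hpq, hne⟩ := hword w.toList hnil w.chain
      have h1 := Equiv.congr_fun hg p
      rw [map_mul, Equiv.Perm.mul_apply, hpq.prod_apply α _ _ hof hαt, hof] at h1
      exact (hne w.head⁻¹ (inv_smul_eq_iff.2 h1.symm)).elim
  · obtain ⟨f, f', h⟩ := htup n x y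
    refine ⟨HNNExtension.of f'⁻¹ * HNNExtension.t * HNNExtension.of f, fun i ↦ ?_⟩
    rw [map_mul, map_mul, Equiv.Perm.mul_apply, Equiv.Perm.mul_apply, hof f, hαt _ (h i), hof,
      inv_smul_smul]

end Separation

/-! ### The surface relation as an HNN relation -/

section SurfaceWord

/-- The product `w (n - 1) * ⋯ * w 0`, where `w i = b i * (a i)⁻¹ * (b i)⁻¹ * a i`. -/
def surfaceWord {G : Type*} [Group G] (a b : ℕ → G) : ℕ → G
  | 0 => 1
  | n + 1 => b n * (a n)⁻¹ * (b n)⁻¹ * a n * surfaceWord a b n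

variable {G H : Type*} [Group G] [Group H]

theorem map_surfaceWord (f : G →* H) (a b : ℕ → G) :
    ∀ n, f (surfaceWord a b n) = surfaceWord (fun i ↦ f (a i)) (fun i ↦ f (b i)) n
  | 0 => map_one f
  | n + 1 => by simp [surfaceWord, map_surfaceWord f a b n]

theorem surfaceWord_congr {a a' b b' : ℕ → G} :
    ∀ {n : ℕ}, (∀ i < n, a i = a' i) → (∀ i < n, b i = b' i) →
      surfaceWord a b n = surfaceWord a' b' n
  | 0, _, _ => rfl
  | n + 1, ha, hb => by
    rw [surfaceWord, surfaceWord, ha n n.lt_succ_self, hb n n.lt_succ_self,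
      surfaceWord_congr (fun i hi ↦ ha i (hi.trans n.lt_succ_self))
        fun i hi ↦ hb i (hi.trans n.lt_succ_self)]

/-- Splits off handle `0`, which supplies the stable letter and `u`; the remaining handles form the
word in `v`. -/
theorem surfaceWord_succ_left (a b : ℕ → G) :
    ∀ n, surfaceWord a b (n + 1) = surfaceWord (fun i ↦ a (i + 1)) (fun i ↦ b (i + 1)) n *
      (b 0 * (a 0)⁻¹ * (b 0)⁻¹ * a 0)
  | 0 => by simp [surfaceWord]
  | n + 1 => by
    rw [surfaceWord, surfaceWord_succ_left a b n, surfaceWord, ← mul_assoc]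

theorem surfaceWord_one_right (a : ℕ → G) : ∀ n, surfaceWord a (fun _ ↦ 1) n = 1
  | 0 => rfl
  | n + 1 => by simp [surfaceWord, surfaceWord_one_right a n]

/-- A group which behaves like the surface group of genus `g`: it is generated by elements
`x i`, `y i` satisfying the surface relation, and any permutations satisfying that relation extend
to a homomorphism. -/
theorem admitsFaithfulHighlyTransitiveAction_of_surfaceWord (g : ℕ) (hg : 1 < g) (x y : ℕ → G)
    (hgen : ∀ K : Subgroup G, (∀ i < g, x i ∈ K ∧ y i ∈ K) → K = ⊤)
    (hrel : surfaceWord x y g = 1)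
    (huniv : ∀ (X : Type) (a b : ℕ → Equiv.Perm X), surfaceWord a b g = 1 →
      ∃ ρ : G →* Equiv.Perm X, ∀ i < g, ρ (x i) = a i ∧ ρ (y i) = b i) :
    AdmitsFaithfulHighlyTransitiveAction G := by
  obtain ⟨n, rfl⟩ : ∃ n, g = n + 1 := ⟨g - 1, by omega⟩
  let F := FreeGroup (Option (Fin n ⊕ Fin n))
  let a : ℕ → F := fun i ↦ if h : i < n then FreeGroup.of (some (.inl ⟨i, h⟩)) else 1
  let b : ℕ → F := fun i ↦ if h : i < n then FreeGroup.of (some (.inr ⟨i, h⟩)) else 1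
  let u : F := FreeGroup.of none
  let v : F := surfaceWord a b n * u
  -- Killing every `b i` kills the surface word, so `u` and `v` have the same image, while `a 0` is
  -- left to play the role of `z`.
  let θ : F →* Equiv.Perm (ℤ × ℤ) := FreeGroup.lift fun
    | none => columnShift (.ofAdd 1)
    | some (.inl _) => rowShift (.ofAdd 1)
    | some (.inr _) => 1
  have hθu : θ u = columnShift (.ofAdd 1) := FreeGroup.lift_apply_of
  have hθv : θ v = columnShift (.ofAdd 1) := by
    rw [map_mul, hθu, map_surfaceWord]
    have : (fun i ↦ θ (b i)) = fun _ ↦ 1 := by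
      ext1 i
      simp only [b]
      split_ifs
      · exact FreeGroup.lift_apply_of
      · exact map_one θ
    rw [this, surfaceWord_one_right, one_mul]
  have hθz : θ (a 0) = rowShift (.ofAdd 1) := by
    simp only [a, dif_pos (show 0 < n by omega)]
    exact FreeGroup.lift_apply_of
  have hord : ∀ w : F, θ w = columnShift (.ofAdd 1) → ∀ k : ℤ, w ^ k = 1 → k = 0 := by
    intro w hw k hk
    refine eq_zero_of_columnShift_zpow_eq_one ?_
    rw [← hw, ← map_zpow, hk, map_one]
  obtain ⟨φ, hφ⟩ := exists_zpowers_mulEquiv (hord u hθu) (hord v hθv)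
  have : Countable F := Quotient.countable
  obtain ⟨α, hα, htrans⟩ := HNNExtension.exists_injective_perm_hom θ hθu hθv hθz φ hφ
  let f : F →* G := FreeGroup.lift fun
    | none => y 0
    | some (.inl i) => x (i + 1)
    | some (.inr i) => y (i + 1)
  have hfu : f u = y 0 := FreeGroup.lift_apply_of
  have hfa : ∀ i < n, f (a i) = x (i + 1) := fun i hi ↦ by
    simp only [a, dif_pos hi]
    exact FreeGroup.lift_apply_of
  have hfb : ∀ i < n, f (b i) = y (i + 1) := fun i hi ↦ by
    simp only [b, dif_pos hi]
    exact FreeGroup.lift_apply_of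
  -- With handle `0` split off, the surface relation is the HNN relation for the stable letter `(x
  -- 0)⁻¹`.
  have hft : (x 0)⁻¹ * f u = f v * (x 0)⁻¹ := by
    rw [map_mul, map_surfaceWord, hfu, surfaceWord_congr hfa hfb]
    rw [surfaceWord_succ_left] at hrel
    have h := eq_inv_of_mul_eq_one_left hrel
    rw [h]; group
  let ψ := HNNExtension.lift (φ := φ) f (x 0)⁻¹ (mul_map_eq_of_generator hφ f _ hft)
  have hψof : ∀ w, ψ (HNNExtension.of w) = f w := by simp [ψ]
  have hψt : ψ HNNExtension.t = (x 0)⁻¹ := by simp [ψ]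
  let A : ℕ → Equiv.Perm (F × ℕ) := fun
    | 0 => (α HNNExtension.t)⁻¹
    | i + 1 => α (HNNExtension.of (a i))
  let B : ℕ → Equiv.Perm (F × ℕ) := fun
    | 0 => α (HNNExtension.of u)
    | i + 1 => α (HNNExtension.of (b i))
  have hAB : surfaceWord A B (n + 1) = 1 := by
    have h1 : (HNNExtension.t : HNNExtension F _ _ φ) * HNNExtension.of u =
        HNNExtension.of v * HNNExtension.t := by
      have := HNNExtension.t_mul_of (φ := φ) ⟨u, Subgroup.mem_zpowers u⟩
      rwa [hφ] at this
    have h2 : surfaceWord (fun i ↦ A (i + 1)) (fun i ↦ B (i + 1)) n =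
        α (HNNExtension.of (surfaceWord a b n)) := by
      rw [← MonoidHom.comp_apply, map_surfaceWord]; rfl
    have h3 : α HNNExtension.t * α (HNNExtension.of u) =
        α (HNNExtension.of (surfaceWord a b n)) * α (HNNExtension.of u) * α HNNExtension.t := by
      rw [← map_mul, h1, map_mul, map_mul, map_mul]
    rw [surfaceWord_succ_left, h2]
    change _ * (α (HNNExtension.of u) * ((α HNNExtension.t)⁻¹)⁻¹ * (α (HNNExtension.of u))⁻¹ *
      (α HNNExtension.t)⁻¹) = 1
    rw [inv_inv]
    calc _ = α (HNNExtension.of (surfaceWord a b n)) * α (HNNExtension.of u) *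
          α HNNExtension.t * (α (HNNExtension.of u))⁻¹ * (α HNNExtension.t)⁻¹ := by group
      _ = 1 := by rw [← h3]; group
  obtain ⟨ρ, hρ⟩ := huniv (F × ℕ) A B hAB
  -- As `α` is injective and `ψ` will be shown surjective, this forces `ρ` to be injective.
  have hρψ : ρ.comp ψ = α := by
    refine HNNExtension.hom_ext ?_ ?_
    · refine FreeGroup.ext_hom _ _ ?_
      rintro (_ | i | i)
      · change ρ (ψ (HNNExtension.of u)) = α (HNNExtension.of u)
        rw [hψof, hfu, (hρ 0 (by omega)).2]
      · have hi : a i = FreeGroup.of (some (.inl i)) := dif_pos i.2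
        change ρ (ψ (HNNExtension.of (FreeGroup.of (some (.inl i))))) =
          α (HNNExtension.of (FreeGroup.of (some (.inl i))))
        rw [← hi, hψof, hfa i i.2, (hρ (i + 1) (by omega)).1]
      · have hi : b i = FreeGroup.of (some (.inr i)) := dif_pos i.2
        change ρ (ψ (HNNExtension.of (FreeGroup.of (some (.inr i))))) =
          α (HNNExtension.of (FreeGroup.of (some (.inr i))))
        rw [← hi, hψof, hfb i i.2, (hρ (i + 1) (by omega)).2]
    · rw [MonoidHom.comp_apply, hψt, map_inv, (hρ 0 (by omega)).1]
      exact inv_inv _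
  have hψ : Function.Surjective ψ := by
    rw [← MonoidHom.range_eq_top]
    refine hgen _ fun i hi ↦ ?_
    rcases i with _ | i
    · exact ⟨inv_mem_iff.1 ⟨_, hψt⟩, ⟨_, (hψof u).trans hfu⟩⟩
    · exact ⟨⟨_, (hψof _).trans (hfa i (by omega))⟩, ⟨_, (hψof _).trans (hfb i (by omega))⟩⟩
  have hρinj : Function.Injective ρ := by
    rw [injective_iff_map_eq_one]
    intro γ hγ
    obtain ⟨w, rfl⟩ := hψ γ
    rw [← MonoidHom.comp_apply, hρψ] at hγ
    rw [(injective_iff_map_eq_one α).1 hα w hγ, map_one]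
  let act : MulAction G (F × ℕ) := MulAction.compHom _ ρ
  have hact : ∀ (γ : G) (p : F × ℕ), act.toSMul.smul γ p = ρ γ p := fun _ _ ↦ rfl
  refine ⟨F × ℕ, inferInstance, inferInstance, act, ⟨fun h ↦ hρinj (Equiv.ext h)⟩, fun m _ ↦ ?_⟩
  refine ⟨fun p q ↦ ?_⟩
  obtain ⟨w, hw⟩ := htrans m p q
  refine ⟨ψ w, DFunLike.ext _ _ fun i ↦ ?_⟩
  rw [← hw, ← hρψ]
  rfl

end SurfaceWord

/-! ### Coverings of a quotient space glued from labels -/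

section Gluing

open Topology unitInterval

variable {D : Type*} [TopologicalSpace D]

/-- The loop in the quotient which runs along the image of a path from `z₀` to `z`, and back along
the image of a path from `z₀` to a point `w` which is identified with `z`. -/
noncomputable def crossingLoop [PathConnectedSpace D] (R : D → D → Prop) (z₀ : D) {z w : D}
    (h : Quot.mk R z = Quot.mk R w) : FundamentalGroup (Quot R) (Quot.mk R z₀) :=
  .fromPath (.mk (((PathConnectedSpace.somePath z₀ z).map continuous_quot_mk).trans
    (((PathConnectedSpace.somePath z₀ w).map continuous_quot_mk).cast rfl h).symm))

/-- Open sets which cover `D` and descend to the quotient by `R`, with locally constant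
permutations of `X` on them which differ on identified points by a factor not depending on the
chart. -/
structure GluingAtlas (R : D → D → Prop) (X : Type*) where
  /-- The index type. -/
  index : Type
  /-- The domain of a chart. -/
  dom : index → Set D
  isOpen_dom : ∀ i, IsOpen (dom i)
  exists_mem_dom : ∀ z, ∃ i, z ∈ dom i
  mem_dom_iff : ∀ i z w, R z w → (z ∈ dom i ↔ w ∈ dom i)
  /-- The label of a point in a chart. -/
  label : index → D → Equiv.Perm X
  eventually_label_eq : ∀ i, ∀ z ∈ dom i, ∀ᶠ w in 𝓝 z, label i w = label i z
  exists_label_eq : ∀ z w, R z w → ∃ c, ∀ i, z ∈ dom i → label i z = label i w * c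

namespace GluingAtlas

variable {R : D → D → Prop} {X : Type*} (C : GluingAtlas R X)

/-- The image of the domain of a chart in the quotient. -/
def quotDom (i : C.index) : Set (Quot R) :=
  {p | Quot.lift (· ∈ C.dom i) (fun z w h ↦ propext (C.mem_dom_iff i z w h)) p}

theorem isOpen_quotDom (i : C.index) : IsOpen (C.quotDom i) :=
  isQuotientMap_quot_mk.isOpen_preimage.1 (C.isOpen_dom i)

open Classical in
/-- The change of labels between two charts. -/
noncomputable def change (i j : C.index) : Quot R → Equiv.Perm X :=
  Quot.lift (fun z ↦ if z ∈ C.dom i ∧ z ∈ C.dom j then C.label j z * (C.label i z)⁻¹ else 1) <| by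
    intro z w h
    obtain ⟨c, hc⟩ := C.exists_label_eq z w h
    simp only [← C.mem_dom_iff _ z w h]
    split_ifs with hij
    -- The factor `c` is the same in both charts and cancels, so the transition function descends to
    -- the quotient.
    · rw [hc i hij.1, hc j hij.2]; group
    · rfl

theorem change_mk {i j : C.index} {z : D} (hi : z ∈ C.dom i) (hj : z ∈ C.dom j) :
    C.change i j (Quot.mk R z) = C.label j z * (C.label i z)⁻¹ :=
  if_pos ⟨hi, hj⟩

theorem eventually_change_eq {i j : C.index} {p : Quot R} (hi : p ∈ C.quotDom i)
    (hj : p ∈ C.quotDom j) : ∀ᶠ p' in 𝓝 p, C.change i j p' = C.change i j p := by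
  set S : Set (Quot R) := {p' | (p' ∈ C.quotDom i ∧ p' ∈ C.quotDom j) ∧
    C.change i j p' = C.change i j p} with hS
  suffices IsOpen S from Filter.mem_of_superset (this.mem_nhds ⟨⟨hi, hj⟩, rfl⟩) fun _ h ↦ h.2
  rw [← isQuotientMap_quot_mk.isOpen_preimage, isOpen_iff_mem_nhds]
  rintro z ⟨⟨hzi, hzj⟩, hz⟩
  filter_upwards [(C.isOpen_dom i).mem_nhds hzi, (C.isOpen_dom j).mem_nhds hzj,
    C.eventually_label_eq i z hzi, C.eventually_label_eq j z hzj] with w hwi hwj hi' hj'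
  refine ⟨⟨hwi, hwj⟩, ?_⟩
  rw [← hz, C.change_mk hwi hwj, C.change_mk hzi hzj, hi', hj']

/-- The bundle over the quotient with fiber `X` which is glued by the labels. -/
noncomputable def bundle [TopologicalSpace X] [DiscreteTopology X] :
    FiberBundleCore C.index (Quot R) X where
  baseSet := C.quotDom
  isOpen_baseSet := C.isOpen_quotDom
  indexAt p := (C.exists_mem_dom p.exists_rep.choose).choose
  mem_baseSet_at p := by
    have h : Quot.mk R p.exists_rep.choose ∈ C.quotDom _ :=
      (C.exists_mem_dom p.exists_rep.choose).choose_spec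
    have hp := p.exists_rep.choose_spec
    exact Eq.mp (congr_arg (· ∈ C.quotDom _) hp) h
  coordChange i j p := C.change i j p
  coordChange_self i p hp v := by
    obtain ⟨z, rfl⟩ := p.exists_rep
    rw [C.change_mk hp hp, mul_inv_cancel, Equiv.Perm.one_apply]
  continuousOn_coordChange i j := by
    rintro ⟨p, v⟩ ⟨⟨hi, hj⟩, -⟩
    refine ContinuousAt.continuousWithinAt ?_
    have h1 : ∀ᶠ x : Quot R × X in 𝓝 (p, v), C.change i j x.1 = C.change i j p :=
      continuous_fst.tendsto (p, v) (C.eventually_change_eq hi hj)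
    have h2 : ContinuousAt (fun x : Quot R × X ↦ C.change i j p x.2) (p, v) :=
      (continuous_of_discreteTopology.comp continuous_snd).continuousAt
    exact h2.congr (h1.mono fun x hx ↦ by simp only [hx])
  coordChange_comp i j k p hp v := by
    obtain ⟨z, rfl⟩ := p.exists_rep
    obtain ⟨⟨hi, hj⟩, hk⟩ := hp
    rw [C.change_mk hj hk, C.change_mk hi hj, C.change_mk hi hk, ← Equiv.Perm.mul_apply]
    group

variable [TopologicalSpace X] [DiscreteTopology X]

/-- The lift of the quotient map to the glued bundle with given label. -/
noncomputable def lift (ξ : X) (z : D) : C.bundle.TotalSpace :=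
  ⟨Quot.mk R z, C.label (C.bundle.indexAt (Quot.mk R z)) z ξ⟩

theorem continuous_lift (ξ : X) : Continuous (C.lift ξ) := by
  refine continuous_generateFrom_iff.2 ?_
  simp only [Set.mem_iUnion, Set.mem_singleton_iff, exists_prop]
  rintro _ ⟨i, s, hs, rfl⟩
  rw [isOpen_iff_mem_nhds]
  rintro z ⟨hz, hzs⟩
  have hval : ∀ w ∈ C.dom i,
      C.bundle.localTrivAsPartialEquiv i (C.lift ξ w) = (Quot.mk R w, C.label i w ξ) := by
    intro w hw
    rw [FiberBundleCore.localTrivAsPartialEquiv_apply]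
    refine Prod.ext rfl ?_
    change C.change (C.bundle.indexAt (Quot.mk R w)) i (Quot.mk R w) (C.label _ w ξ) = _
    rw [C.change_mk (C.bundle.mem_baseSet_at (Quot.mk R w)) hw]
    simp
  have hzi : z ∈ C.dom i := hz
  have hcont : ContinuousAt (fun w ↦ (Quot.mk R w, C.label i z ξ)) z :=
    (continuous_quot_mk.prodMk continuous_const).continuousAt
  have hzs' : (Quot.mk R z, C.label i z ξ) ∈ s := by
    have : C.bundle.localTrivAsPartialEquiv i (C.lift ξ z) ∈ s := hzs
    rwa [hval z hzi] at this
  filter_upwards [(C.isOpen_dom i).mem_nhds hzi, C.eventually_label_eq i z hzi,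
    hcont (hs.mem_nhds hzs')] with w hw hl hws
  refine ⟨hw, ?_⟩
  rw [Set.mem_preimage, hval w hw, hl]
  exact hws

theorem lift_eq_lift {z w : D} (h : Quot.mk R z = Quot.mk R w) {c : Equiv.Perm X}
    (hc : ∀ i, z ∈ C.dom i → C.label i z = C.label i w * c) (ξ : X) :
    C.lift ξ z = C.lift (c ξ) w := by
  have := hc _ (C.bundle.mem_baseSet_at (Quot.mk R z))
  unfold lift
  rw [this, ← h]
  rfl

theorem isCoveringMap_proj : IsCoveringMap C.bundle.proj :=
  FiberBundle.isCoveringMap (F := X) (E := C.bundle.Fiber)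

/-- The crossing loop lifts as follows: out to `z` on the sheet `ξ`, which by `lift_eq_lift` meets
the sheet `c ξ` over `w`, then back to `z₀` on that sheet. The monodromy is therefore `c`. -/
theorem exists_fundamentalGroup_hom {X : Type*} (C : GluingAtlas R X) [PathConnectedSpace D]
    (z₀ : D) :
    ∃ ρ : FundamentalGroup (Quot R) (Quot.mk R z₀) →* Equiv.Perm X,
      ∀ (z w : D) (h : Quot.mk R z = Quot.mk R w) (c : Equiv.Perm X),
        (∀ i, z ∈ C.dom i → C.label i z = C.label i w * c) → ρ (crossingLoop R z₀ h) = c := by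
  let _ : TopologicalSpace X := ⊥
  have _ : DiscreteTopology X := ⟨rfl⟩
  have cov := C.isCoveringMap_proj
  let e : X ≃ C.bundle.proj ⁻¹' {Quot.mk R z₀} := Equiv.ofBijective
    (fun ξ ↦ ⟨C.lift ξ z₀, rfl⟩) <| by
      constructor
      · intro ξ ξ' h
        have h1 := Subtype.ext_iff.1 h
        simp only [lift] at h1
        exact (C.label _ z₀).injective (eq_of_heq (Bundle.TotalSpace.mk.inj h1).2)
      · rintro ⟨⟨p, v⟩, hp⟩
        obtain rfl : p = Quot.mk R z₀ := hp
        refine ⟨(C.label (C.bundle.indexAt (Quot.mk R z₀)) z₀)⁻¹ v, Subtype.ext ?_⟩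
        exact congr_arg (Bundle.TotalSpace.mk (Quot.mk R z₀)) (Equiv.apply_symm_apply _ v)
  refine ⟨(e.permCongrHom.symm : _ →* _).comp (cov.monodromyPerm (Quot.mk R z₀)), ?_⟩
  intro z w h c hc
  ext ξ
  change e.symm (cov.monodromyPerm (Quot.mk R z₀) (crossingLoop R z₀ h) (e ξ)) = c ξ
  rw [Equiv.symm_apply_eq, IsCoveringMap.coe_monodromyPerm]
  let r : Path (C.lift ξ z₀) (C.lift ξ z) :=
    (PathConnectedSpace.somePath z₀ z).map (C.continuous_lift ξ)
  let r' : Path (C.lift (c ξ) z₀) (C.lift (c ξ) w) :=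
    (PathConnectedSpace.somePath z₀ w).map (C.continuous_lift (c ξ))
  refine cov.monodromy_eq_of_map_eq
    (.mk (r.trans (r'.cast rfl (C.lift_eq_lift h hc ξ)).symm)) ?_
  refine congr_arg Path.Homotopic.Quotient.mk ?_
  ext t
  change C.bundle.proj ((r.trans (r'.cast rfl (C.lift_eq_lift h hc ξ)).symm) t) = _
  change _ = (((PathConnectedSpace.somePath z₀ z).map continuous_quot_mk).trans
    (((PathConnectedSpace.somePath z₀ w).map continuous_quot_mk).cast rfl h).symm) t
  rw [Path.trans_apply, Path.trans_apply]
  split_ifs <;> rfl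

end GluingAtlas

end Gluing

/-! ### Generation of the fundamental group by crossing loops -/

section Generation

open Topology unitInterval

namespace Path.Homotopic.Quotient

variable {Y : Type*} [TopologicalSpace Y] {p a a' b b' c : Y}

theorem symm_distrib (α : Path.Homotopic.Quotient p a) (β : Path.Homotopic.Quotient a b) :
    (α.trans β).symm = β.symm.trans α.symm := by
  induction α using Path.Homotopic.Quotient.ind
  induction β using Path.Homotopic.Quotient.ind
  rw [← mk_trans, ← mk_symm, ← mk_symm, ← mk_symm, ← mk_trans, Path.trans_symm]

theorem symm_symm' (α : Path.Homotopic.Quotient p a) : α.symm.symm = α := by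
  induction α using Path.Homotopic.Quotient.ind
  rw [← mk_symm, ← mk_symm, Path.symm_symm]

theorem trans_symm_trans_cancel (α : Path.Homotopic.Quotient p a)
    (β : Path.Homotopic.Quotient b a) (γ : Path.Homotopic.Quotient a c) :
    (α.trans β.symm).trans (β.trans γ) = α.trans γ := by
  rw [trans_assoc, ← trans_assoc β.symm, symm_trans, refl_trans]

theorem cast_symm_trans_cancel (α : Path.Homotopic.Quotient p a)
    (β : Path.Homotopic.Quotient p b) (γ : Path.Homotopic.Quotient p c) (h : a = b) (h' : b = c) :
    (α.trans (β.cast rfl h).symm).trans (β.trans (γ.cast rfl h').symm) =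
      α.trans (γ.cast rfl (h.trans h')).symm := by
  subst h h'
  simp only [cast_rfl_rfl]
  exact trans_symm_trans_cancel _ _ _

/-- Meant for a path `ω` that a deformation contracts: `ε` and `ε'` are then the trajectories of its
endpoints. -/
theorem trans_cast_symm_eq (α : Path.Homotopic.Quotient p a) (α' : Path.Homotopic.Quotient p a')
    (ω : Path.Homotopic.Quotient a a') (ε : Path.Homotopic.Quotient a b)
    (ε' : Path.Homotopic.Quotient a' b') (h : b = b')
    (hω : ω.trans ε' = ε.cast rfl h.symm) :
    (α.trans ω).trans α'.symm = (α.trans ε).trans ((α'.trans ε').cast rfl h).symm := by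
  subst h
  simp only [cast_rfl_rfl] at hω ⊢
  rw [← hω, symm_distrib, ← trans_assoc α, trans_assoc (α.trans ω), ← trans_assoc ε',
    trans_symm, refl_trans]

end Path.Homotopic.Quotient

variable {D : Type*} [TopologicalSpace D] {R : D → D → Prop} {z₀ : D}

/-- The class of the image in the quotient of a path in `D`. -/
noncomputable def spoke [PathConnectedSpace D] (R : D → D → Prop) (z₀ z : D) :
    Path.Homotopic.Quotient (Quot.mk R z₀) (Quot.mk R z) :=
  .mk ((PathConnectedSpace.somePath z₀ z).map continuous_quot_mk)

theorem crossingLoop_eq_trans [PathConnectedSpace D] {z w : D} (h : Quot.mk R z = Quot.mk R w) :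
    crossingLoop R z₀ h = .fromPath ((spoke R z₀ z).trans ((spoke R z₀ w).cast rfl h).symm) :=
  rfl

theorem spoke_trans [SimplyConnectedSpace D] {z w : D} (e : Path z w) :
    (spoke R z₀ z).trans (.mk (e.map continuous_quot_mk)) = spoke R z₀ w := by
  rw [spoke, spoke, ← Path.Homotopic.Quotient.mk_trans, ← Path.map_trans]
  exact Path.Homotopic.Quotient.eq.2 ((SimplyConnectedSpace.paths_homotopic
    ((PathConnectedSpace.somePath z₀ z).trans e) _).map ⟨Quot.mk R, continuous_quot_mk⟩)

theorem crossingLoop_mul [PathConnectedSpace D] {z w w' : D} (h : Quot.mk R z = Quot.mk R w)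
    (h' : Quot.mk R w = Quot.mk R w') :
    crossingLoop R z₀ h' * crossingLoop R z₀ h = crossingLoop R z₀ (h.trans h') :=
  Path.Homotopic.Quotient.cast_symm_trans_cancel (spoke R z₀ z) (spoke R z₀ w) (spoke R z₀ w') h h'

theorem crossingLoop_self [PathConnectedSpace D] {z : D} (h : Quot.mk R z = Quot.mk R z) :
    crossingLoop R z₀ h = 1 :=
  mul_eq_left.1 (crossingLoop_mul h h)

theorem crossingLoop_symm [PathConnectedSpace D] {z w : D} (h : Quot.mk R z = Quot.mk R w) :
    crossingLoop R z₀ h.symm = (crossingLoop R z₀ h)⁻¹ := by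
  rw [eq_inv_iff_mul_eq_one, crossingLoop_mul, crossingLoop_self]

/-- As `D` is simply connected, the paths from `z₀` to `z'` and `w'` may be taken through `z` and
`w`. Their final pieces have equal images and cancel. -/
theorem crossingLoop_eq_of_path [SimplyConnectedSpace D] {z z' w w' : D}
    (h : Quot.mk R z = Quot.mk R w) (h' : Quot.mk R z' = Quot.mk R w') (e : Path z z')
    (e' : Path w w') (he : ∀ t, Quot.mk R (e t) = Quot.mk R (e' t)) :
    crossingLoop R z₀ h = crossingLoop R z₀ h' := by
  rw [crossingLoop_eq_trans, crossingLoop_eq_trans, ← spoke_trans e, ← spoke_trans e']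
  have key : ∀ {p a a' b b' : Quot R} (α : Path.Homotopic.Quotient p a)
      (α' : Path.Homotopic.Quotient p a') (ε : Path a b) (ε' : Path a' b') (h : a = a')
      (h' : b = b'), (∀ t, ε t = ε' t) → α.trans (α'.cast rfl h).symm =
        (α.trans (.mk ε)).trans ((α'.trans (.mk ε')).cast rfl h').symm := by
    intro p a a' b b' α α' ε ε' h h' hε
    subst h h'
    obtain rfl : ε = ε' := Path.ext (funext hε)
    simp only [Path.Homotopic.Quotient.cast_rfl_rfl]
    rw [Path.Homotopic.Quotient.symm_distrib, Path.Homotopic.Quotient.trans_assoc,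
      ← Path.Homotopic.Quotient.trans_assoc (.mk ε), Path.Homotopic.Quotient.trans_symm,
      Path.Homotopic.Quotient.refl_trans]
  exact key _ _ _ _ h h' he

/-- Equality in the quotient is generated by `R`, and crossing loops multiply along chains of
identifications. -/
theorem crossingLoop_mem [PathConnectedSpace D]
    {K : Subgroup (FundamentalGroup (Quot R) (Quot.mk R z₀))}
    (hK : ∀ (z w : D) (h : R z w), crossingLoop R z₀ (Quot.sound h) ∈ K) {z w : D}
    (h : Quot.mk R z = Quot.mk R w) : crossingLoop R z₀ h ∈ K := by
  have := Quot.eqvGen_exact h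
  induction this with
  | rel z w hzw => exact hK z w hzw
  | refl z => rw [crossingLoop_self]; exact K.one_mem
  | symm z w hzw ih => rw [crossingLoop_symm h.symm]; exact K.inv_mem (ih _)
  | trans z w w' h₁ h₂ ih₁ ih₂ =>
    rw [← crossingLoop_mul (Quot.eqvGen_sound h₁) (Quot.eqvGen_sound h₂)]
    exact K.mul_mem (ih₂ _) (ih₁ _)

/-- A path class in the quotient is carried by `K` if it becomes an element of `K` when its
endpoints are joined to the base point through `D`. -/
def CarriedBy [PathConnectedSpace D] (K : Subgroup (FundamentalGroup (Quot R) (Quot.mk R z₀)))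
    {p p' : Quot R} (ω : Path.Homotopic.Quotient p p') : Prop :=
  ∀ (z z' : D) (h : Quot.mk R z = p) (h' : Quot.mk R z' = p'),
    FundamentalGroup.fromPath ((((spoke R z₀ z).cast rfl h.symm).trans ω).trans
      ((spoke R z₀ z').cast rfl h'.symm).symm) ∈ K

namespace CarriedBy

variable [PathConnectedSpace D] {K : Subgroup (FundamentalGroup (Quot R) (Quot.mk R z₀))}

theorem trans {p p' p'' : Quot R} {ω : Path.Homotopic.Quotient p p'}
    {ω' : Path.Homotopic.Quotient p' p''} (hω : CarriedBy K ω) (hω' : CarriedBy K ω') :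
    CarriedBy K (ω.trans ω') := by
  rintro z z'' rfl rfl
  obtain ⟨z', rfl⟩ := p'.exists_rep
  have := K.mul_mem (hω' z' z'' rfl rfl) (hω z z' rfl rfl)
  rw [FundamentalGroup.mul_def] at this
  convert this using 1
  rw [Path.Homotopic.Quotient.trans_assoc (_ : Path.Homotopic.Quotient _ _) ω',
    Path.Homotopic.Quotient.trans_symm_trans_cancel, Path.Homotopic.Quotient.trans_assoc,
    Path.Homotopic.Quotient.trans_assoc, Path.Homotopic.Quotient.trans_assoc]

theorem symm {p p' : Quot R} {ω : Path.Homotopic.Quotient p p'} (hω : CarriedBy K ω) :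
    CarriedBy K ω.symm := by
  rintro z' z rfl rfl
  have := K.inv_mem (hω z z' rfl rfl)
  rw [FundamentalGroup.inv_def, Path.Homotopic.Quotient.symm_distrib,
    Path.Homotopic.Quotient.symm_distrib, Path.Homotopic.Quotient.symm_symm'] at this
  convert this using 1
  rw [Path.Homotopic.Quotient.trans_assoc]

theorem cast {p p' a a' : Quot R} {ω : Path.Homotopic.Quotient p p'} (hω : CarriedBy K ω)
    (h : a = p) (h' : a' = p') : CarriedBy K (ω.cast h h') := by
  subst h h'
  rwa [Path.Homotopic.Quotient.cast_rfl_rfl]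

end CarriedBy

/-- A deformation of the part of `D` lying over an open set `V` of the quotient which descends to
the quotient, and whose final map is locally constant in the quotient. -/
structure GluingContraction (R : D → D → Prop) (V : Set (Quot R)) where
  /-- The deformation. -/
  toFun : D → I → D
  isOpen : IsOpen V
  continuousOn : ContinuousOn (fun x : D × I ↦ toFun x.1 x.2) ((Quot.mk R ⁻¹' V) ×ˢ Set.univ)
  apply_zero : ∀ z, toFun z 0 = z
  mk_eq_mk : ∀ z w, Quot.mk R z ∈ V → R z w → ∀ s, Quot.mk R (toFun z s) = Quot.mk R (toFun w s)
  eventually_eq : ∀ z, Quot.mk R z ∈ V →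
    ∀ᶠ w in 𝓝 z, Quot.mk R (toFun w 1) = Quot.mk R (toFun z 1)

namespace GluingContraction

variable {V : Set (Quot R)} (H : GluingContraction R V)

theorem mk_eq_of_mk_eq {z w : D} (hz : Quot.mk R z ∈ V) (h : Quot.mk R z = Quot.mk R w) (s : I) :
    Quot.mk R (H.toFun z s) = Quot.mk R (H.toFun w s) := by
  have := Quot.eqvGen_exact h
  induction this with
  | rel z w hzw => exact H.mk_eq_mk z w hz hzw s
  | refl z => rfl
  | symm z w hzw ih => exact (ih (h ▸ hz) h.symm).symm
  | trans z w w' h₁ h₂ ih₁ ih₂ =>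
    have h := Quot.eqvGen_sound h₁
    exact (ih₁ hz h).trans (ih₂ (h ▸ hz) (Quot.eqvGen_sound h₂))

/-- The trajectory of a point under the deformation. -/
def trajectory {z : D} (hz : Quot.mk R z ∈ V) : Path z (H.toFun z 1) where
  toFun s := H.toFun z s
  continuous_toFun := H.continuousOn.comp_continuous (f := fun s : I ↦ (z, s)) (by fun_prop)
    fun _ ↦ ⟨hz, trivial⟩
  source' := H.apply_zero z
  target' := rfl

/-- Restricted to the open set `V`, the quotient map is still a quotient map. Currying the time
variable avoids asking whether its product with `I` is one. -/
theorem exists_homotopy :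
    ∃ (g : C(V, Quot R)) (F : (⟨Subtype.val, continuous_subtype_val⟩ : C(V, Quot R)).Homotopy g),
      IsLocallyConstant g ∧
      ∀ (z : D) (hz : Quot.mk R z ∈ V) (s : I), F (s, ⟨Quot.mk R z, hz⟩) =
        Quot.mk R (H.toFun z s) := by
  have hq : IsQuotientMap (V.restrictPreimage (Quot.mk R)) :=
    isQuotientMap_quot_mk.restrictPreimage_isOpen H.isOpen
  let κ : C(Quot.mk R ⁻¹' V, C(I, Quot R)) := ContinuousMap.curry
    ⟨fun x ↦ Quot.mk R (H.toFun x.1 x.2), continuous_quot_mk.comp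
      (H.continuousOn.comp_continuous (f := fun x : (Quot.mk R ⁻¹' V) × I ↦ (x.1.1, x.2))
        (by fun_prop) fun x ↦ ⟨x.1.2, trivial⟩)⟩
  let Q : C(Quot.mk R ⁻¹' V, V) := ⟨_, hq.continuous⟩
  have hκ : Function.FactorsThrough κ Q := by
    rintro ⟨z, hz⟩ ⟨w, hw⟩ h
    ext s
    exact H.mk_eq_of_mk_eq hz (Subtype.ext_iff.1 h) s
  let κ' : C(V, C(I, Quot R)) := IsQuotientMap.lift (f := Q) hq κ hκ
  have hκ' : ∀ (z : D) (hz : Quot.mk R z ∈ V) (s : I),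
      κ' ⟨Quot.mk R z, hz⟩ s = Quot.mk R (H.toFun z s) := by
    intro z hz s
    have := IsQuotientMap.lift_comp (f := Q) hq κ hκ
    exact congr_arg (fun f : C(I, Quot R) ↦ f s) (DFunLike.congr_fun this ⟨z, hz⟩)
  refine ⟨⟨fun p ↦ κ' p 1, by fun_prop⟩, ⟨⟨fun x ↦ κ' x.2 x.1, by fun_prop⟩, ?_, fun _ ↦ rfl⟩,
    ?_, fun z hz s ↦ hκ' z hz s⟩
  · rintro ⟨p, hp⟩
    obtain ⟨z, rfl⟩ := p.exists_rep
    change κ' _ 0 = _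
    rw [hκ', H.apply_zero]
    rfl
  · intro S
    rw [← hq.isOpen_preimage]
    revert S
    change IsLocallyConstant fun z : Quot.mk R ⁻¹' V ↦ κ' ⟨Quot.mk R z.1, z.2⟩ 1
    rw [IsLocallyConstant.iff_eventually_eq]
    rintro ⟨z, hz⟩
    have h1 := continuous_subtype_val.tendsto (⟨z, hz⟩ : Quot.mk R ⁻¹' V)
      (H.eventually_eq z hz)
    filter_upwards [h1] with w hw
    rw [hκ', hκ']
    exact hw

/-- The deformation ends in a locally constant map, so it turns `ω` into a constant path. Hence `ω`
is homotopic to the trajectory of its start followed by the reversed trajectory of its end. Both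
lift to `D`, and closing up gives a crossing loop. -/
theorem carriedBy [SimplyConnectedSpace D] (H : GluingContraction R V)
    {K : Subgroup (FundamentalGroup (Quot R) (Quot.mk R z₀))}
    (hK : ∀ (z w : D) (h : R z w), crossingLoop R z₀ (Quot.sound h) ∈ K) {p p' : V}
    (ω : Path p p') : CarriedBy K (.mk (ω.map continuous_subtype_val)) := by
  obtain ⟨g, F, hg, hF⟩ := H.exists_homotopy
  rintro z z' h h'
  obtain ⟨p, hp⟩ := p
  obtain ⟨p', hp'⟩ := p'
  dsimp only at h h'
  subst h h'
  simp only [Path.Homotopic.Quotient.cast_rfl_rfl]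
  have hconst : ∀ t, g (ω t) = g (ω 0) := fun t ↦
    (hg.comp_continuous ω.continuous).apply_eq_of_preconnectedSpace t 0
  have hF₁ : ∀ (z : D) (hz : Quot.mk R z ∈ V), g ⟨Quot.mk R z, hz⟩ = Quot.mk R (H.toFun z 1) := by
    intro z hz
    rw [← hF, F.apply_one]
  have hend : Quot.mk R (H.toFun z 1) = Quot.mk R (H.toFun z' 1) := by
    have := hconst 1
    rw [ω.source, ω.target, hF₁, hF₁] at this
    exact this.symm
  have key := Path.Homotopic.map_trans_evalAt F ω
  rw [Path.Homotopic.Quotient.trans_cast_symm_eq (spoke R z₀ z) (spoke R z₀ z') _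
    (.mk ((H.trajectory hp).map continuous_quot_mk))
    (.mk ((H.trajectory hp').map continuous_quot_mk)) hend ?_, spoke_trans, spoke_trans]
  · exact crossingLoop_mem hK hend
  · have e₁ : F.evalAt ⟨Quot.mk R z, hp⟩ =
        ((H.trajectory hp).map continuous_quot_mk).cast rfl (hF₁ z hp) := by
      ext s; exact hF z hp s
    have e₂ : F.evalAt ⟨Quot.mk R z', hp'⟩ =
        ((H.trajectory hp').map continuous_quot_mk).cast rfl (hF₁ z' hp') := by
      ext s; exact hF z' hp' s
    have e₃ : ω.map (map_continuous g) =
        (Path.refl (Quot.mk R (H.toFun z 1))).cast (hF₁ z hp) ((hF₁ z' hp').trans hend.symm) := by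
      ext t
      change g (ω t) = Quot.mk R (H.toFun z 1)
      rw [hconst t, ω.source, hF₁]
    rw [e₁, e₂, e₃] at key
    have aux : ∀ {a a' b b' c c' : Quot R} (ω : Path a a') (ε : Path a b) (ε' : Path a' b')
        (h₁ : c = b) (h₂ : c' = b') (h₃ : c' = b) (h : b = b'),
        (ω.trans (ε'.cast rfl h₂)).Homotopic
          ((ε.cast rfl h₁).trans ((Path.refl b).cast h₁ h₃)) →
        (Path.Homotopic.Quotient.mk ω).trans (.mk ε') =
          (Path.Homotopic.Quotient.mk ε).cast rfl h.symm := by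
      intro a a' b b' c c' ω ε ε' h₁ h₂ h₃ h hh
      subst h₁ h₃ h
      rw [Path.Homotopic.Quotient.cast_rfl_rfl, ← Path.Homotopic.Quotient.mk_trans]
      refine (Path.Homotopic.Quotient.eq.2 hh).trans ?_
      rw [Path.Homotopic.Quotient.mk_trans]
      exact Path.Homotopic.Quotient.trans_refl _
    exact aux _ _ _ _ _ _ hend key

end GluingContraction

/-- Extend the loop to `ℝ`. That the piece between two parameters is carried by `K` is a symmetric,
transitive relation holding locally, so by connectedness it holds between `0` and `1`. -/
theorem eq_top_of_crossingLoop_mem [SimplyConnectedSpace D]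
    (hcover : ∀ p : Quot R, ∃ V : Set (Quot R), p ∈ V ∧ Nonempty (GluingContraction R V))
    {K : Subgroup (FundamentalGroup (Quot R) (Quot.mk R z₀))}
    (hK : ∀ (z w : D) (h : R z w), crossingLoop R z₀ (Quot.sound h) ∈ K) : K = ⊤ := by
  rw [eq_top_iff]
  rintro γ -
  obtain ⟨γ, rfl⟩ := Path.Homotopic.Quotient.mk_surjective γ
  have hγ : Continuous γ.extend := γ.continuous_extend
  let P : ℝ → ℝ → Prop := fun a b ↦
    CarriedBy K (.mk ((PathConnectedSpace.somePath a b).map hγ))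
  -- Paths in `ℝ` with common endpoints are homotopic, so the chosen path does not matter.
  have hP : ∀ {a b : ℝ} (ω : Path a b), CarriedBy K (.mk (ω.map hγ)) → P a b := by
    intro a b ω h
    have : Path.Homotopic.Quotient.mk (ω.map hγ) =
        .mk ((PathConnectedSpace.somePath a b).map hγ) :=
      Path.Homotopic.Quotient.eq.2
        ((SimplyConnectedSpace.paths_homotopic ω _).map ⟨_, hγ⟩)
    rwa [this] at h
  have : Std.Symm P := ⟨fun a b h ↦ hP (PathConnectedSpace.somePath a b).symm (by
    rw [← Path.map_symm, Path.Homotopic.Quotient.mk_symm]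
    exact h.symm)⟩
  have hlocal : ∀ a : ℝ, ∀ᶠ b in 𝓝 a, P a b := by
    intro a
    obtain ⟨V, haV, ⟨H⟩⟩ := hcover (γ.extend a)
    have hnhds : γ.extend ⁻¹' V ∈ 𝓝 a := hγ.continuousAt (H.isOpen.mem_nhds haV)
    filter_upwards [pathComponentIn_mem_nhds hnhds] with b hb
    obtain ⟨ω, hω⟩ := hb
    let ω' : Path (⟨γ.extend a, haV⟩ : V) ⟨γ.extend b, by simpa using hω 1⟩ :=
      { toFun := fun t ↦ ⟨γ.extend (ω t), hω t⟩
        continuous_toFun := by fun_prop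
        source' := by simp
        target' := by simp }
    exact hP ω (H.carriedBy hK ω')
  have hmain : P 0 1 := PreconnectedSpace.induction₂ P hlocal
    ⟨fun a b c h h' ↦ hP ((PathConnectedSpace.somePath a b).trans
      (PathConnectedSpace.somePath b c)) (by
        rw [Path.map_trans, Path.Homotopic.Quotient.mk_trans]
        exact h.trans h')⟩ 0 1
  have hfin : CarriedBy K (.mk γ) := by
    let ω : Path (0 : ℝ) 1 :=
      { toFun := fun t ↦ t
        continuous_toFun := continuous_subtype_val
        source' := rfl
        target' := rfl }
    have h1 : Path.Homotopic.Quotient.mk ((PathConnectedSpace.somePath (0 : ℝ) 1).map hγ) =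
        .mk (ω.map hγ) := Path.Homotopic.Quotient.eq.2
        ((SimplyConnectedSpace.paths_homotopic _ ω).map ⟨_, hγ⟩)
    have h2 : γ = (ω.map hγ).cast (by simp) (by simp) := by
      ext t
      exact (γ.extend_apply t.2).symm
    have h3 : CarriedBy K _ := hmain
    rw [h1] at h3
    rw [h2]
    exact h3.cast _ _
  have := hfin z₀ z₀ rfl rfl
  simp only [Path.Homotopic.Quotient.cast_rfl_rfl] at this
  have hz : spoke R z₀ z₀ = .refl _ := by
    have := spoke_trans (R := R) (z₀ := z₀) (PathConnectedSpace.somePath z₀ z₀).symm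
    rw [← this, ← Path.map_symm, Path.Homotopic.Quotient.mk_symm]
    exact Path.Homotopic.Quotient.trans_symm _
  rw [hz, Path.Homotopic.Quotient.refl_trans] at this
  have hs : (Path.Homotopic.Quotient.refl (Quot.mk R z₀)).symm = .refl _ := by
    rw [← Path.Homotopic.Quotient.mk_refl, ← Path.Homotopic.Quotient.mk_symm, Path.refl_symm]
  rw [hs, Path.Homotopic.Quotient.trans_refl] at this
  exact this

end Generation

/-! ### Angular positions in the polygon, and its sectors -/

section Position

open Topology

namespace SurfaceModel

variable {g : ℕ}

theorem coe_boundaryPoint (t : ℝ) :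
    (boundaryPoint g t : ℂ) = Circle.exp (2 * Real.pi * (t / (4 * g))) := rfl

theorem norm_boundaryPoint (t : ℝ) : ‖(boundaryPoint g t : ℂ)‖ = 1 := Circle.norm_coe _

theorem boundaryPoint_ne_zero (t : ℝ) : (boundaryPoint g t : ℂ) ≠ 0 := Circle.coe_ne_zero _

theorem continuous_boundaryPoint : Continuous (boundaryPoint g) :=
  Continuous.subtype_mk (by fun_prop) _

theorem boundaryPoint_eq_iff (hg : 0 < g) {t t' : ℝ} :
    boundaryPoint g t = boundaryPoint g t' ↔ ∃ k : ℤ, t = t' + k * (4 * g) := by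
  have hg' : (g : ℝ) ≠ 0 := by positivity
  rw [Subtype.ext_iff, coe_boundaryPoint, coe_boundaryPoint, Circle.coe_inj, Circle.exp_eq_exp]
  refine exists_congr fun k ↦ ?_
  have hpi := Real.pi_ne_zero
  constructor
  · intro h
    field_simp at h
    linarith
  · rintro rfl
    field_simp

/-- A position at which the ray through `z` meets the boundary of the `4 * g`-gon. -/
noncomputable def position (g : ℕ) (z : ℂ) : ℝ := z.arg / (2 * Real.pi) * (4 * g)

theorem norm_mul_boundaryPoint_position (hg : 0 < g) (z : ℂ) :
    (‖z‖ : ℂ) * boundaryPoint g (position g z) = z := by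
  have hg' : (g : ℝ) ≠ 0 := by positivity
  have hpi := Real.pi_ne_zero
  have : 2 * Real.pi * (position g z / (4 * g)) = z.arg := by
    unfold position; field_simp
  rw [coe_boundaryPoint, this, Circle.coe_exp, Complex.norm_mul_exp_arg_mul_I]

theorem exists_position_boundaryPoint (hg : 0 < g) (t : ℝ) :
    ∃ k : ℤ, position g (boundaryPoint g t) = t + k * (4 * g) := by
  rw [← boundaryPoint_eq_iff hg]
  have := norm_mul_boundaryPoint_position hg (boundaryPoint g t : ℂ)
  rw [norm_boundaryPoint, Complex.ofReal_one, one_mul] at this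
  exact Subtype.ext this

/-- The argument jumps along the negative axis but is continuous as an angle, so periodic properties
of the position are still locally stable. -/
theorem eventually_position (hg : 0 < g) {P : ℝ → Prop}
    (hP : ∀ (t : ℝ) (k : ℤ), P t → P (t + k * (4 * g))) {z : ℂ} (hz : z ≠ 0)
    (h : ∀ᶠ t in 𝓝 (position g z), P t) : ∀ᶠ w in 𝓝 z, P (position g w) := by
  have hg' : (g : ℝ) ≠ 0 := by positivity
  have hpi := Real.pi_ne_zero
  let S : Set ℝ := {θ | P (θ / (2 * Real.pi) * (4 * g))}
  have hS : S ∈ 𝓝 z.arg := by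
    have hc : Continuous fun θ : ℝ ↦ θ / (2 * Real.pi) * (4 * g) := by fun_prop
    exact hc.continuousAt h
  have hS' : (Real.Angle.coe '' S) ∈ 𝓝 (z.arg : Real.Angle) :=
    QuotientAddGroup.isOpenMap_coe.image_mem_nhds hS
  filter_upwards [(Complex.continuousAt_arg_coe_angle hz) hS'] with w hw
  obtain ⟨θ, hθ, h⟩ := hw
  obtain ⟨k, hk⟩ := Real.Angle.angle_eq_iff_two_pi_dvd_sub.1 h
  have := hP _ (-k) hθ
  convert this using 1
  unfold position
  have : w.arg = θ - 2 * Real.pi * k := by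
    have : θ - w.arg = 2 * Real.pi * k := hk
    linarith
  rw [this]
  push_cast
  field_simp
  ring

/-- The offset of the charts around the vertices and around the sides. -/
noncomputable def offset (b : Bool) : ℝ := if b then 1 / 2 else 0

/-- The part of the disc on the rays which do not meet the midpoints of the sides, respectively the
vertices. -/
def sector (g : ℕ) (b : Bool) : Set Disc :=
  {z | (z : ℂ) ≠ 0 ∧ Int.fract (position g z + offset b) ≠ 0}

/-- The signed distance of a position to the nearest vertex, respectively midpoint of a side. -/
noncomputable def deviation (b : Bool) (t : ℝ) : ℝ := Int.fract (t + offset b) - 1 / 2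

theorem add_mul_four (t : ℝ) (k : ℤ) (b : Bool) :
    t + k * (4 * g) + offset b = t + offset b + ((k * (4 * g) : ℤ) : ℝ) := by
  push_cast; ring

theorem fract_add_mul_four (t : ℝ) (k : ℤ) (b : Bool) :
    Int.fract (t + k * (4 * g) + offset b) = Int.fract (t + offset b) := by
  rw [add_mul_four, Int.fract_add_intCast]

theorem floor_add_mul_four (t : ℝ) (k : ℤ) (b : Bool) :
    ⌊t + k * (4 * g) + offset b⌋ = ⌊t + offset b⌋ + k * (4 * g) := by
  rw [add_mul_four, Int.floor_add_intCast]

theorem deviation_add_mul_four (t : ℝ) (k : ℤ) (b : Bool) :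
    deviation b (t + k * (4 * g)) = deviation b t := by
  rw [deviation, fract_add_mul_four, deviation]

theorem deviation_position_boundaryPoint (hg : 0 < g) (b : Bool) (t : ℝ) :
    deviation b (position g (boundaryPoint g t)) = deviation b t := by
  obtain ⟨k, hk⟩ := exists_position_boundaryPoint hg t
  rw [hk, deviation_add_mul_four]

theorem boundaryPoint_mem_sector (hg : 0 < g) (b : Bool) (t : ℝ) :
    boundaryPoint g t ∈ sector g b ↔ Int.fract (t + offset b) ≠ 0 := by
  obtain ⟨k, hk⟩ := exists_position_boundaryPoint hg t
  change _ ∧ _ ↔ _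
  rw [hk, fract_add_mul_four]
  exact and_iff_right (boundaryPoint_ne_zero t)

theorem eventually_floor_eq {x : ℝ} (hx : Int.fract x ≠ 0) :
    ∀ᶠ y in 𝓝 x, ⌊y⌋ = ⌊x⌋ ∧ Int.fract y ≠ 0 := by
  have h0 : 0 < Int.fract x := lt_of_le_of_ne (Int.fract_nonneg x) hx.symm
  have h1 : (⌊x⌋ : ℝ) < x := by
    have := Int.self_sub_floor x; linarith
  filter_upwards [Ioo_mem_nhds h1 (Int.lt_floor_add_one x)] with y hy
  have hf : ⌊y⌋ = ⌊x⌋ := Int.floor_eq_iff.2 ⟨hy.1.le, hy.2⟩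
  refine ⟨hf, ?_⟩
  rw [Int.fract, hf]
  have := hy.1
  linarith

theorem eventually_add_offset {b : Bool} {t : ℝ} (ht : Int.fract (t + offset b) ≠ 0) :
    ∀ᶠ t' in 𝓝 t, ⌊t' + offset b⌋ = ⌊t + offset b⌋ ∧ Int.fract (t' + offset b) ≠ 0 :=
  (continuous_add_const (offset b)).continuousAt (eventually_floor_eq ht)

theorem eventually_mem_sector (hg : 0 < g) {b : Bool} {z : Disc} (hz : z ∈ sector g b) :
    ∀ᶠ w in 𝓝 z, w ∈ sector g b := by
  have h1 : ∀ᶠ w in 𝓝 (z : ℂ), Int.fract (position g w + offset b) ≠ 0 :=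
    eventually_position hg (P := fun t ↦ Int.fract (t + offset b) ≠ 0)
      (fun t k h ↦ by rwa [fract_add_mul_four]) hz.1
      ((eventually_add_offset hz.2).mono fun _ h ↦ h.2)
  have h2 : ∀ᶠ w in 𝓝 (z : ℂ), w ≠ 0 := isOpen_ne.mem_nhds hz.1
  exact continuousAt_subtype_val (h2.and h1)

theorem isOpen_sector (hg : 0 < g) (b : Bool) : IsOpen (sector g b) :=
  isOpen_iff_mem_nhds.2 fun _ hz ↦ eventually_mem_sector hg hz

theorem eventually_floor_position (hg : 0 < g) {b : Bool} {z : Disc} (hz : z ∈ sector g b) :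
    ∀ᶠ w : Disc in 𝓝 z, ∃ k : ℤ, ⌊position g w + offset b⌋ =
      ⌊position g z + offset b⌋ + k * (4 * g) := by
  have h1 : ∀ᶠ w in 𝓝 (z : ℂ), ∃ k : ℤ, ⌊position g w + offset b⌋ =
      ⌊position g z + offset b⌋ + k * (4 * g) :=
    eventually_position hg
      (P := fun t ↦ ∃ k : ℤ, ⌊t + offset b⌋ = ⌊position g z + offset b⌋ + k * (4 * g))
      (by
        rintro t k ⟨l, hl⟩
        refine ⟨l + k, ?_⟩
        rw [floor_add_mul_four, hl]; ring) hz.1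
      ((eventually_add_offset hz.2).mono fun _ h ↦ ⟨0, by rw [h.1]; ring⟩)
  exact continuousAt_subtype_val h1

theorem continuousAt_deviation {b : Bool} {t : ℝ} (ht : Int.fract (t + offset b) ≠ 0) :
    ContinuousAt (deviation b) t := by
  have : ContinuousAt (fun t' : ℝ ↦ t' + offset b - ⌊t + offset b⌋ - 1 / 2) t := by fun_prop
  refine this.congr ((eventually_add_offset ht).mono fun t' h ↦ ?_)
  rw [deviation, Int.fract, h.1]

theorem continuousAt_deviation_position (hg : 0 < g) {b : Bool} {z : Disc} (hz : z ∈ sector g b) :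
    ContinuousAt (fun w : Disc ↦ deviation b (position g w)) z := by
  intro O hO
  have h1 : ∀ᶠ w in 𝓝 (z : ℂ), deviation b (position g w) ∈ O :=
    eventually_position hg (P := fun t ↦ deviation b t ∈ O)
      (fun t k h ↦ by rwa [deviation_add_mul_four]) hz.1 (continuousAt_deviation hz.2 hO)
  exact continuousAt_subtype_val h1

/-- Every pair of identified points has positions with integral sum. -/
theorem Glue.exists_position {z w : Disc} (h : Glue g z w) :
    ∃ (t t' : ℝ) (m : ℤ), z = boundaryPoint g t ∧ w = boundaryPoint g t' ∧ t + t' = m := by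
  cases h with
  | a j s => exact ⟨_, _, 8 * j + 3, rfl, rfl, by push_cast; ring⟩
  | b j s => exact ⟨_, _, 8 * j + 5, rfl, rfl, by push_cast; ring⟩

theorem exists_two_mul_offset (b : Bool) : ∃ m : ℤ, 2 * offset b = m := by
  cases b
  · exact ⟨0, by simp [offset]⟩
  · exact ⟨1, by simp [offset]⟩

theorem fract_eq_of_add_eq {x y : ℝ} {m : ℤ} (h : x + y = m) (hx : Int.fract x ≠ 0) :
    Int.fract y = 1 - Int.fract x := by
  have : y = -x + m := by linarith
  rw [this, Int.fract_add_intCast, Int.fract_neg hx]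

theorem fract_ne_zero_iff_of_add_eq {x y : ℝ} {m : ℤ} (h : x + y = m) :
    Int.fract x ≠ 0 ↔ Int.fract y ≠ 0 := by
  have key : ∀ {x y : ℝ}, x + y = m → Int.fract x ≠ 0 → Int.fract y ≠ 0 := by
    intro x y h hx
    rw [fract_eq_of_add_eq h hx]
    have := Int.fract_lt_one x
    linarith
  exact ⟨key h, key (by rw [add_comm]; exact h)⟩

theorem add_offset_add {b : Bool} {t t' : ℝ} {m : ℤ} (h : t + t' = m) :
    ∃ m' : ℤ, (t + offset b) + (t' + offset b) = m' := by
  obtain ⟨l, hl⟩ := exists_two_mul_offset b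
  exact ⟨m + l, by push_cast; linarith⟩

theorem Glue.mem_sector_iff (hg : 0 < g) (b : Bool) {z w : Disc} (h : Glue g z w) :
    z ∈ sector g b ↔ w ∈ sector g b := by
  obtain ⟨t, t', m, rfl, rfl, hm⟩ := h.exists_position
  obtain ⟨m', hm'⟩ := add_offset_add (b := b) hm
  rw [boundaryPoint_mem_sector hg, boundaryPoint_mem_sector hg, fract_ne_zero_iff_of_add_eq hm']

/-- Side pairings reverse direction: paired positions have integral sum, so they lie on opposite
sides of their nearest vertices or midpoints. -/
theorem deviation_eq_neg {b : Bool} {t t' : ℝ} {m : ℤ} (h : t + t' = m)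
    (ht : Int.fract (t + offset b) ≠ 0) : deviation b t' = -deviation b t := by
  obtain ⟨m', hm'⟩ := add_offset_add (b := b) h
  rw [deviation, fract_eq_of_add_eq hm' ht, deviation]
  ring

theorem exists_mem_sector {z : Disc} (hz : (z : ℂ) ≠ 0) : ∃ b, z ∈ sector g b := by
  by_cases h : Int.fract (position g z + offset false) = 0
  · refine ⟨true, hz, ?_⟩
    have h1 : position g z + offset true = position g z + offset false + 1 / 2 := by
      simp [offset]
    have h2 : position g z + offset false = ⌊position g z + offset false⌋ := by
      have := Int.self_sub_floor (position g z + offset false); linarith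
    rw [h1, h2, add_comm, Int.fract_add_intCast, Int.fract_eq_self.2 ⟨by norm_num, by norm_num⟩]
    norm_num
  · exact ⟨false, hz, h⟩

/-- The points of the quotient lying under a sector. -/
def quotSector (hg : 0 < g) (b : Bool) : Set (Quot (Glue g)) :=
  {p | Quot.lift (· ∈ sector g b) (fun _ _ h ↦ propext (h.mem_sector_iff hg b)) p}

/-- The points of the quotient lying under the open disc. -/
def quotInterior (g : ℕ) : Set (Quot (Glue g)) :=
  {p | Quot.lift (fun z : Disc ↦ ‖(z : ℂ)‖ < 1) (fun z w h ↦ by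
    obtain ⟨t, t', -, rfl, rfl, -⟩ := h.exists_position
    simp only [norm_boundaryPoint]) p}

theorem norm_mul_boundaryPoint_le {x : ℝ} (h₀ : 0 ≤ x) (h₁ : x ≤ 1) (t : ℝ) :
    ‖(x : ℂ) * (boundaryPoint g t : ℂ)‖ ≤ 1 := by
  rw [norm_mul, norm_boundaryPoint, mul_one, Complex.norm_real, Real.norm_of_nonneg h₀]
  exact h₁

/-- The point at radius `x` and position `t`. -/
noncomputable def polarPoint (g : ℕ) (x : unitInterval) (t : ℝ) : Disc :=
  ⟨(x : ℝ) * (boundaryPoint g t : ℂ),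
    mem_closedBall_zero_iff.2 (norm_mul_boundaryPoint_le x.2.1 x.2.2 t)⟩

theorem polarPoint_one (t : ℝ) : polarPoint g 1 t = boundaryPoint g t :=
  Subtype.ext (by simp [polarPoint])

/-- The radius of a point of the disc. -/
noncomputable def radius (z : Disc) : unitInterval :=
  ⟨‖(z : ℂ)‖, norm_nonneg _, mem_closedBall_zero_iff.1 z.2⟩

theorem polarPoint_radius_position (hg : 0 < g) (z : Disc) :
    polarPoint g (radius z) (position g z) = z :=
  Subtype.ext (norm_mul_boundaryPoint_position hg z)

end SurfaceModel

end Position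

/-! ### Contractions of the sectors and of the open disc -/

section Contraction

open Topology unitInterval

namespace SurfaceModel

variable {g : ℕ}

theorem boundaryPoint_add (t t' : ℝ) :
    (boundaryPoint g (t + t') : ℂ) = boundaryPoint g t * boundaryPoint g t' := by
  rw [coe_boundaryPoint, coe_boundaryPoint, coe_boundaryPoint, add_div, mul_add, Circle.exp_add,
    Circle.coe_mul]

/-- The vertex, respectively midpoint of a side, which is nearest to the position `t`. -/
noncomputable def nearest (b : Bool) (t : ℝ) : ℝ := ⌊t + offset b⌋ + 1 / 2 - offset b

theorem sub_deviation (b : Bool) (t : ℝ) : t - deviation b t = nearest b t := by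
  rw [deviation, nearest, Int.fract]; ring

/-- The point reached at time `s` when the point at radius `r` and position `t` is moved towards the
nearest vertex, respectively midpoint of a side. -/
noncomputable def slide (g : ℕ) (b : Bool) (z : Disc) (s : I) : Disc :=
  polarPoint g (σ (σ s * σ (radius z))) (position g z - s * deviation b (position g z))

theorem coe_slide_radius (z : Disc) (s : I) :
    ((σ (σ s * σ (radius z)) : I) : ℝ) = (1 - s) * ‖(z : ℂ)‖ + s := by
  simp only [unitInterval.coe_symm_eq, Set.Icc.coe_mul, radius]; ring

theorem slide_zero (hg : 0 < g) (b : Bool) (z : Disc) : slide g b z 0 = z := by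
  simp only [slide, unitInterval.symm_zero, one_mul, unitInterval.symm_symm, Set.Icc.coe_zero,
    zero_mul, sub_zero]
  exact polarPoint_radius_position hg z

theorem slide_one (b : Bool) (z : Disc) :
    slide g b z 1 = boundaryPoint g (nearest b (position g z)) := by
  simp [slide, polarPoint_one, sub_deviation]

theorem slide_boundaryPoint (hg : 0 < g) (b : Bool) (t : ℝ) (s : I) :
    slide g b (boundaryPoint g t) s = boundaryPoint g (t - s * deviation b t) := by
  have h1 : radius (boundaryPoint g t) = 1 := Subtype.ext (norm_boundaryPoint t)
  rw [slide, h1, unitInterval.symm_one, mul_zero, unitInterval.symm_zero, polarPoint_one,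
    deviation_position_boundaryPoint hg, boundaryPoint_eq_iff hg]
  obtain ⟨k, hk⟩ := exists_position_boundaryPoint hg t
  exact ⟨k, by rw [hk]; ring⟩

theorem continuousOn_slide (hg : 0 < g) (b : Bool) :
    ContinuousOn (fun x : Disc × I ↦ slide g b x.1 x.2) (sector g b ×ˢ Set.univ) := by
  rw [continuousOn_iff_continuous_domRestrict]
  refine Continuous.subtype_mk ?_ _
  -- Written relative to `z`, the formula involves only the deviation, which is continuous on the
  -- sector, unlike the position.
  have hformula : ∀ x : (sector g b ×ˢ (Set.univ : Set I) : Set (Disc × I)),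
      (slide g b x.1.1 x.1.2 : ℂ) = ((((1 - x.1.2) * ‖(x.1.1 : ℂ)‖ + x.1.2) / ‖(x.1.1 : ℂ)‖ : ℝ) : ℂ) *
        x.1.1 * boundaryPoint g (-(x.1.2 * deviation b (position g x.1.1))) := by
    rintro ⟨⟨z, s⟩, hz, -⟩
    have hz0 : ‖(z : ℂ)‖ ≠ 0 := norm_ne_zero_iff.2 hz.1
    change ((σ (σ s * σ (radius z)) : I) : ℂ) *
      (boundaryPoint g (position g z - s * deviation b (position g z)) : ℂ) = _
    rw [sub_eq_add_neg, boundaryPoint_add, coe_slide_radius]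
    dsimp only
    have hp := norm_mul_boundaryPoint_position hg (z : ℂ)
    have hz0' : ((‖(z : ℂ)‖ : ℝ) : ℂ) ≠ 0 := by exact_mod_cast hz0
    push_cast
    field_simp
    linear_combination ((1 - (s : ℂ)) * ‖(z : ℂ)‖ + s) *
      (boundaryPoint g (-(s * deviation b (position g z))) : ℂ) * hp
  refine Continuous.congr ?_ fun x ↦ (hformula x).symm
  have hdev : Continuous fun x : (sector g b ×ˢ (Set.univ : Set I) : Set (Disc × I)) ↦
      deviation b (position g x.1.1) :=
    continuous_iff_continuousAt.2 fun x ↦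
      (continuousAt_deviation_position hg x.2.1).comp (f := fun x : (sector g b ×ˢ
        (Set.univ : Set I) : Set (Disc × I)) ↦ x.1.1) (by fun_prop)
  have hnorm : ∀ x : (sector g b ×ˢ (Set.univ : Set I) : Set (Disc × I)), ‖(x.1.1 : ℂ)‖ ≠ 0 :=
    fun x ↦ norm_ne_zero_iff.2 x.2.1.1
  have hbp : Continuous fun x : (sector g b ×ˢ (Set.univ : Set I) : Set (Disc × I)) ↦
      (boundaryPoint g (-(x.1.2 * deviation b (position g x.1.1))) : ℂ) :=
    (continuous_boundaryPoint.comp (by fun_prop)).subtype_val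
  refine (Continuous.mul ?_ (by fun_prop)).mul hbp
  refine Complex.continuous_ofReal.comp (Continuous.div (by fun_prop) (by fun_prop) hnorm)

/-- The target of a point of side `n` lies on that same side, so sliding never leaves the side. For
`b = false` the end `s = 1`, where the floor would jump to the next side, is excluded by `h`. -/
theorem nearest_sub_mem {b : Bool} {n : ℤ} {s : I} (h : Int.fract (n + s + offset b : ℝ) ≠ 0) :
    nearest b (n + s) - n ∈ I := by
  have h0 := s.2.1
  have h1 := s.2.2
  have e1 : (n + s + offset b : ℝ) = (s + offset b : ℝ) + n := by ring
  rw [e1, Int.fract_add_intCast] at h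
  rw [nearest, e1, Int.floor_add_intCast]
  cases b
  · simp only [offset, Bool.false_eq_true, if_false, add_zero] at h ⊢
    have hs : (s : ℝ) < 1 := lt_of_le_of_ne h1 fun h' ↦ h (by rw [h']; simp)
    have : ⌊(s : ℝ)⌋ = 0 := Int.floor_eq_iff.2 ⟨by simpa using h0, by simpa using hs⟩
    rw [this]
    constructor <;> push_cast <;> linarith
  · simp only [offset, if_true] at h ⊢
    have h2 : 0 ≤ ⌊(s : ℝ) + 1 / 2⌋ := Int.floor_nonneg.2 (by linarith)
    have h3 : ⌊(s : ℝ) + 1 / 2⌋ ≤ 1 := by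
      have : ⌊(s : ℝ) + 1 / 2⌋ < 2 := Int.floor_lt.2 (by push_cast; linarith)
      omega
    have h2' : (0 : ℝ) ≤ ⌊(s : ℝ) + 1 / 2⌋ := by exact_mod_cast h2
    have h3' : (⌊(s : ℝ) + 1 / 2⌋ : ℝ) ≤ 1 := by exact_mod_cast h3
    constructor <;> push_cast <;> linarith

theorem exists_sub_deviation {b : Bool} {n : ℤ} {s : I}
    (h : Int.fract (n + s + offset b : ℝ) ≠ 0) (r : I) :
    ∃ s' : I, (n + s : ℝ) - r * deviation b (n + s) = n + s' := by
  have h1 := nearest_sub_mem h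
  rw [← sub_deviation] at h1
  have h2 := convex_Icc (0 : ℝ) 1 s.2 h1 (sub_nonneg.2 r.2.2) r.2.1 (by ring)
  refine ⟨⟨_, h2⟩, ?_⟩
  simp only [smul_eq_mul]
  ring

theorem glue_slide (hg : 0 < g) (b : Bool) {z w : Disc} (hz : z ∈ sector g b) (h : Glue g z w)
    (r : I) : Glue g (slide g b z r) (slide g b w r) := by
  cases h with
  | a j s =>
    rw [boundaryPoint_mem_sector hg] at hz
    have hsum : (4 * (j : ℕ) + s : ℝ) + (4 * (j : ℕ) + 3 - s) = ((8 * j + 3 : ℤ) : ℝ) := by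
      push_cast; ring
    rw [slide_boundaryPoint hg, slide_boundaryPoint hg, deviation_eq_neg hsum hz]
    have e : (4 * (j : ℕ) : ℝ) = ((4 * j : ℤ) : ℝ) := by push_cast; ring
    obtain ⟨s', hs'⟩ := exists_sub_deviation (n := 4 * j) (s := s) (b := b) (by rwa [e] at hz) r
    rw [← e] at hs'
    convert Glue.a j s' using 2; linarith
  | b j s =>
    rw [boundaryPoint_mem_sector hg] at hz
    have hsum : (4 * (j : ℕ) + 1 + s : ℝ) + (4 * (j : ℕ) + 4 - s) = ((8 * j + 5 : ℤ) : ℝ) := by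
      push_cast; ring
    rw [slide_boundaryPoint hg, slide_boundaryPoint hg, deviation_eq_neg hsum hz]
    have e : (4 * (j : ℕ) + 1 : ℝ) = ((4 * j + 1 : ℤ) : ℝ) := by push_cast; ring
    obtain ⟨s', hs'⟩ := exists_sub_deviation (n := 4 * j + 1) (s := s) (b := b)
      (by rwa [e] at hz) r
    rw [← e] at hs'
    convert Glue.b j s' using 2; linarith

/-- The contraction of a sector along the rays and the sides. -/
noncomputable def sectorContraction (hg : 0 < g) (b : Bool) :
    GluingContraction (Glue g) (quotSector hg b) where
  toFun := slide g b
  isOpen := isQuotientMap_quot_mk.isOpen_preimage.1 (isOpen_sector hg b)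
  continuousOn := continuousOn_slide hg b
  apply_zero := slide_zero hg b
  mk_eq_mk _ _ hz h s := Quot.sound (glue_slide hg b hz h s)
  eventually_eq z hz := by
    filter_upwards [eventually_floor_position hg hz] with w hw
    obtain ⟨k, hk⟩ := hw
    rw [slide_one, slide_one]
    congr 1
    rw [boundaryPoint_eq_iff hg]
    refine ⟨k, ?_⟩
    rw [nearest, nearest, hk]
    push_cast
    ring

/-- The contraction of the open disc to its center. -/
noncomputable def interiorContraction (g : ℕ) :
    GluingContraction (Glue g) (quotInterior g) where
  toFun z s := ⟨(1 - (s : ℝ) : ℝ) * (z : ℂ), mem_closedBall_zero_iff.2 <| by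
    rw [norm_mul, Complex.norm_real, Real.norm_of_nonneg (sub_nonneg.2 s.2.2)]
    exact mul_le_one₀ (sub_le_self _ s.2.1) (norm_nonneg _) (mem_closedBall_zero_iff.1 z.2)⟩
  isOpen := by
    rw [← isQuotientMap_quot_mk.isOpen_preimage]
    exact isOpen_lt (f := fun z : Disc ↦ ‖(z : ℂ)‖) (g := fun _ ↦ (1 : ℝ))
      (by fun_prop) continuous_const
  continuousOn := (Continuous.subtype_mk (by fun_prop) _).continuousOn
  apply_zero z := Subtype.ext (by simp)
  mk_eq_mk z w hz h s := by
    obtain ⟨t, t', -, rfl, rfl, -⟩ := h.exists_position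
    exact absurd (norm_boundaryPoint t) (ne_of_lt hz)
  eventually_eq z _ := by simp

theorem exists_gluingContraction (hg : 0 < g) (p : Quot (Glue g)) :
    ∃ V : Set (Quot (Glue g)), p ∈ V ∧ Nonempty (GluingContraction (Glue g) V) := by
  obtain ⟨z, rfl⟩ := p.exists_rep
  by_cases hz : (z : ℂ) = 0
  · refine ⟨quotInterior g, ?_, ⟨interiorContraction g⟩⟩
    change ‖(z : ℂ)‖ < 1
    simp [hz]
  · obtain ⟨b, hb⟩ := exists_mem_sector (g := g) hz
    exact ⟨quotSector hg b, hb, ⟨sectorContraction hg b⟩⟩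

end SurfaceModel

end Contraction

/-! ### The labelled atlas of the polygon -/

section Labels

open Topology unitInterval

namespace SurfaceModel

variable {g : ℕ} {G : Type*} [Group G]

/-- The labels of the corners (for `b = true`) and of the sides (for `b = false`) of the polygon. -/
def cornerLabel (A B : ℕ → G) (b : Bool) (n : ℕ) : G :=
  match b, n % 4 with
  | false, 0 => A (n / 4)
  | false, 1 => B (n / 4)
  | false, _ => 1
  | true, 0 => (surfaceWord A B (n / 4))⁻¹
  | true, 1 => (surfaceWord A B (n / 4))⁻¹ * (A (n / 4))⁻¹ * B (n / 4) * A (n / 4)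
  | true, 2 => (surfaceWord A B (n / 4))⁻¹ * (A (n / 4))⁻¹ * B (n / 4)
  | true, _ => (surfaceWord A B (n / 4))⁻¹ * (A (n / 4))⁻¹

/-- The periodic extension of `cornerLabel`. -/
def periodicLabel (g : ℕ) (A B : ℕ → G) (b : Bool) (n : ℤ) : G :=
  cornerLabel A B b (n % (4 * g)).toNat

theorem periodicLabel_add (A B : ℕ → G) (b : Bool) (n k : ℤ) :
    periodicLabel g A B b (n + k * (4 * g)) = periodicLabel g A B b n := by
  rw [periodicLabel, Int.add_mul_emod_self_right, periodicLabel]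

theorem periodicLabel_of_lt (A B : ℕ → G) (b : Bool) {n : ℕ} (hn : n < 4 * g) {m : ℤ}
    (hm : m = n) : periodicLabel g A B b m = cornerLabel A B b n := by
  subst hm
  rw [periodicLabel, Int.emod_eq_of_lt (by omega) (by omega), Int.toNat_natCast]

/-- Corner `4 * g` is corner `0` again; the labels around the vertex close up exactly because of the
surface relation. -/
theorem periodicLabel_true_of_le {A B : ℕ → G} (hAB : surfaceWord A B g = 1) {n : ℕ}
    (hn : n ≤ 4 * g) {m : ℤ} (hm : m = n) :
    periodicLabel g A B true m = cornerLabel A B true n := by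
  rcases hn.lt_or_eq with h | h
  · exact periodicLabel_of_lt A B true h hm
  · have h1 : m = (0 : ℤ) + 1 * (4 * g) := by rw [hm, h]; push_cast; ring
    have h2 : n % 4 = 0 := by omega
    have h3 : n / 4 = g := by omega
    rw [h1, periodicLabel_add, periodicLabel]
    simp [cornerLabel, h2, h3, hAB, surfaceWord]

section Values

variable (A B : ℕ → G) (j : ℕ)

theorem div_mod_four {i : ℕ} (hi : i < 4) : (4 * j + i) / 4 = j ∧ (4 * j + i) % 4 = i := by omega

theorem cornerLabel_false_zero : cornerLabel A B false (4 * j) = A j := by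
  obtain ⟨h₁, h₂⟩ := div_mod_four j (i := 0) (by omega)
  rw [add_zero] at h₁ h₂
  simp [cornerLabel, h₁, h₂]

theorem cornerLabel_false_one : cornerLabel A B false (4 * j + 1) = B j := by
  obtain ⟨h₁, h₂⟩ := div_mod_four j (i := 1) (by omega)
  simp [cornerLabel, h₁, h₂]

theorem cornerLabel_false_two : cornerLabel A B false (4 * j + 2) = 1 := by
  obtain ⟨h₁, h₂⟩ := div_mod_four j (i := 2) (by omega)
  simp [cornerLabel, h₂]

theorem cornerLabel_false_three : cornerLabel A B false (4 * j + 3) = 1 := by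
  obtain ⟨h₁, h₂⟩ := div_mod_four j (i := 3) (by omega)
  simp [cornerLabel, h₂]

theorem cornerLabel_true_zero : cornerLabel A B true (4 * j) = (surfaceWord A B j)⁻¹ := by
  obtain ⟨h₁, h₂⟩ := div_mod_four j (i := 0) (by omega)
  rw [add_zero] at h₁ h₂
  simp [cornerLabel, h₁, h₂]

theorem cornerLabel_true_one :
    cornerLabel A B true (4 * j + 1) = (surfaceWord A B j)⁻¹ * (A j)⁻¹ * B j * A j := by
  obtain ⟨h₁, h₂⟩ := div_mod_four j (i := 1) (by omega)
  simp [cornerLabel, h₁, h₂]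

theorem cornerLabel_true_two :
    cornerLabel A B true (4 * j + 2) = (surfaceWord A B j)⁻¹ * (A j)⁻¹ * B j := by
  obtain ⟨h₁, h₂⟩ := div_mod_four j (i := 2) (by omega)
  simp [cornerLabel, h₁, h₂]

theorem cornerLabel_true_three :
    cornerLabel A B true (4 * j + 3) = (surfaceWord A B j)⁻¹ * (A j)⁻¹ := by
  obtain ⟨h₁, h₂⟩ := div_mod_four j (i := 3) (by omega)
  simp [cornerLabel, h₁, h₂]

end Values

/-- A position on a side, away from the points excluded by the chart, lies near the start or near
the end of the side. -/
theorem offset_cases {b : Bool} {n : ℤ} {s : I} (h : Int.fract (n + s + offset b : ℝ) ≠ 0) :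
    (b = false ∧ 0 < (s : ℝ) ∧ (s : ℝ) < 1) ∨ (b = true ∧ (s : ℝ) < 1 / 2) ∨
      (b = true ∧ 1 / 2 < (s : ℝ)) := by
  have h0 := s.2.1
  have h1 := s.2.2
  have e1 : (n + s + offset b : ℝ) = (s + offset b : ℝ) + n := by ring
  rw [e1, Int.fract_add_intCast] at h
  cases b
  · refine Or.inl ⟨rfl, lt_of_le_of_ne h0 ?_, lt_of_le_of_ne h1 ?_⟩
    · intro h'; exact h (by rw [← h']; simp [offset])
    · intro h'; exact h (by rw [h']; simp [offset])
  · refine Or.inr ?_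
    rcases lt_trichotomy (s : ℝ) (1 / 2) with h' | h' | h'
    · exact Or.inl ⟨rfl, h'⟩
    · exact absurd (by rw [h']; norm_num [offset]) h
    · exact Or.inr ⟨rfl, h'⟩

theorem floor_eq_of_bounds {x : ℝ} (n : ℕ) (h₁ : (n : ℝ) ≤ x) (h₂ : x < n + 1) :
    ⌊x⌋ = (n : ℤ) := Int.floor_eq_iff.2 ⟨by exact_mod_cast h₁, by exact_mod_cast h₂⟩

/-- The corner labels are those forced by the value `1` at corner `0` when the pairings are followed
around the vertex through `4 * j`, `4 * j + 3`, `4 * j + 2`, `4 * j + 1`, `4 * j + 4`. -/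
theorem periodicLabel_glue_a {A B : ℕ → G} {b : Bool} {j : ℕ} (hj : j < g) {s : I}
    (h : Int.fract (4 * j + s + offset b : ℝ) ≠ 0) :
    periodicLabel g A B b ⌊(4 * j + s + offset b : ℝ)⌋ =
      periodicLabel g A B b ⌊(4 * j + 3 - s + offset b : ℝ)⌋ * A j := by
  have h0 := s.2.1
  have h1 := s.2.2
  rcases offset_cases (b := b) (n := 4 * j) (s := s) (by push_cast; exact h) with
    ⟨rfl, h2, h3⟩ | ⟨rfl, h2⟩ | ⟨rfl, h2⟩
  · have f1 : ⌊(4 * j + s + offset false : ℝ)⌋ = ((4 * j : ℕ) : ℤ) := by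
      apply floor_eq_of_bounds <;> simp only [offset, Bool.false_eq_true, if_false] <;>
        push_cast <;> linarith
    have f2 : ⌊(4 * j + 3 - s + offset false : ℝ)⌋ = ((4 * j + 2 : ℕ) : ℤ) := by
      apply floor_eq_of_bounds <;> simp only [offset, Bool.false_eq_true, if_false] <;>
        push_cast <;> linarith
    rw [periodicLabel_of_lt A B _ (by omega) f1, periodicLabel_of_lt A B _ (by omega) f2,
      cornerLabel_false_zero, cornerLabel_false_two, one_mul]
  · have f1 : ⌊(4 * j + s + offset true : ℝ)⌋ = ((4 * j : ℕ) : ℤ) := by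
      apply floor_eq_of_bounds <;> simp only [offset, if_true] <;> push_cast <;> linarith
    have f2 : ⌊(4 * j + 3 - s + offset true : ℝ)⌋ = ((4 * j + 3 : ℕ) : ℤ) := by
      apply floor_eq_of_bounds <;> simp only [offset, if_true] <;> push_cast <;> linarith
    rw [periodicLabel_of_lt A B _ (by omega) f1, periodicLabel_of_lt A B _ (by omega) f2,
      cornerLabel_true_zero, cornerLabel_true_three, inv_mul_cancel_right]
  · have f1 : ⌊(4 * j + s + offset true : ℝ)⌋ = ((4 * j + 1 : ℕ) : ℤ) := by
      apply floor_eq_of_bounds <;> simp only [offset, if_true] <;> push_cast <;> linarith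
    have f2 : ⌊(4 * j + 3 - s + offset true : ℝ)⌋ = ((4 * j + 2 : ℕ) : ℤ) := by
      apply floor_eq_of_bounds <;> simp only [offset, if_true] <;> push_cast <;> linarith
    rw [periodicLabel_of_lt A B _ (by omega) f1, periodicLabel_of_lt A B _ (by omega) f2,
      cornerLabel_true_one, cornerLabel_true_two]

theorem periodicLabel_glue_b {A B : ℕ → G} (hAB : surfaceWord A B g = 1) {b : Bool} {j : ℕ}
    (hj : j < g) {s : I} (h : Int.fract (4 * j + 1 + s + offset b : ℝ) ≠ 0) :
    periodicLabel g A B b ⌊(4 * j + 1 + s + offset b : ℝ)⌋ =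
      periodicLabel g A B b ⌊(4 * j + 4 - s + offset b : ℝ)⌋ * B j := by
  have h0 := s.2.1
  have h1 := s.2.2
  rcases offset_cases (b := b) (n := 4 * j + 1) (s := s) (by push_cast; exact h) with
    ⟨rfl, h2, h3⟩ | ⟨rfl, h2⟩ | ⟨rfl, h2⟩
  · have f1 : ⌊(4 * j + 1 + s + offset false : ℝ)⌋ = ((4 * j + 1 : ℕ) : ℤ) := by
      apply floor_eq_of_bounds <;> simp only [offset, Bool.false_eq_true, if_false] <;>
        push_cast <;> linarith
    have f2 : ⌊(4 * j + 4 - s + offset false : ℝ)⌋ = ((4 * j + 3 : ℕ) : ℤ) := by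
      apply floor_eq_of_bounds <;> simp only [offset, Bool.false_eq_true, if_false] <;>
        push_cast <;> linarith
    rw [periodicLabel_of_lt A B _ (by omega) f1, periodicLabel_of_lt A B _ (by omega) f2,
      cornerLabel_false_one, cornerLabel_false_three, one_mul]
  · have f1 : ⌊(4 * j + 1 + s + offset true : ℝ)⌋ = ((4 * j + 1 : ℕ) : ℤ) := by
      apply floor_eq_of_bounds <;> simp only [offset, if_true] <;> push_cast <;> linarith
    -- For the last handle this is corner `4 * g`, so the surface relation is needed.
    have f2 : ⌊(4 * j + 4 - s + offset true : ℝ)⌋ = ((4 * (j + 1) : ℕ) : ℤ) := by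
      apply floor_eq_of_bounds <;> simp only [offset, if_true] <;> push_cast <;> linarith
    rw [periodicLabel_of_lt A B _ (by omega) f1,
      periodicLabel_true_of_le hAB (by omega) f2, cornerLabel_true_one, cornerLabel_true_zero,
      surfaceWord]
    group
  · have f1 : ⌊(4 * j + 1 + s + offset true : ℝ)⌋ = ((4 * j + 2 : ℕ) : ℤ) := by
      apply floor_eq_of_bounds <;> simp only [offset, if_true] <;> push_cast <;> linarith
    have f2 : ⌊(4 * j + 4 - s + offset true : ℝ)⌋ = ((4 * j + 3 : ℕ) : ℤ) := by
      apply floor_eq_of_bounds <;> simp only [offset, if_true] <;> push_cast <;> linarith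
    rw [periodicLabel_of_lt A B _ (by omega) f1, periodicLabel_of_lt A B _ (by omega) f2,
      cornerLabel_true_two, cornerLabel_true_three]

theorem periodicLabel_position (hg : 0 < g) (A B : ℕ → G) (b : Bool) (t : ℝ) :
    periodicLabel g A B b ⌊position g (boundaryPoint g t) + offset b⌋ =
      periodicLabel g A B b ⌊t + offset b⌋ := by
  obtain ⟨k, hk⟩ := exists_position_boundaryPoint hg t
  rw [hk, floor_add_mul_four, periodicLabel_add]

/-- The domains of the charts of the polygon. -/
def chartDom (g : ℕ) : Option Bool → Set Disc
  | none => {z | ‖(z : ℂ)‖ < 1}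
  | some b => sector g b

/-- The labels of the charts of the polygon. -/
noncomputable def chartLabel (g : ℕ) (A B : ℕ → G) : Option Bool → Disc → G
  | none, _ => 1
  | some b, z => periodicLabel g A B b ⌊position g z + offset b⌋

theorem chartLabel_glue_a (hg : 0 < g) (A B : ℕ → G) (j : Fin g) (s : I) (i : Option Bool)
    (hi : boundaryPoint g (4 * (j : ℕ) + s) ∈ chartDom g i) :
    chartLabel g A B i (boundaryPoint g (4 * (j : ℕ) + s)) =
      chartLabel g A B i (boundaryPoint g (4 * (j : ℕ) + 3 - s)) * A j := by
  rcases i with _ | b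
  · exact absurd (norm_boundaryPoint _) (ne_of_lt hi)
  · rw [chartLabel, chartLabel, periodicLabel_position hg, periodicLabel_position hg]
    exact periodicLabel_glue_a j.2 ((boundaryPoint_mem_sector hg b _).1 hi)

theorem chartLabel_glue_b (hg : 0 < g) {A B : ℕ → G} (hAB : surfaceWord A B g = 1) (j : Fin g)
    (s : I) (i : Option Bool) (hi : boundaryPoint g (4 * (j : ℕ) + 1 + s) ∈ chartDom g i) :
    chartLabel g A B i (boundaryPoint g (4 * (j : ℕ) + 1 + s)) =
      chartLabel g A B i (boundaryPoint g (4 * (j : ℕ) + 4 - s)) * B j := by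
  rcases i with _ | b
  · exact absurd (norm_boundaryPoint _) (ne_of_lt hi)
  · rw [chartLabel, chartLabel, periodicLabel_position hg, periodicLabel_position hg]
    exact periodicLabel_glue_b hAB j.2 ((boundaryPoint_mem_sector hg b _).1 hi)

/-- The atlas of the polygon which is labelled by permutations satisfying the surface relation. -/
noncomputable def polygonAtlas (hg : 0 < g) {X : Type*} {A B : ℕ → Equiv.Perm X}
    (hAB : surfaceWord A B g = 1) : GluingAtlas (Glue g) X where
  index := Option Bool
  dom := chartDom g
  isOpen_dom i := by
    rcases i with _ | b
    · exact isOpen_lt (f := fun z : Disc ↦ ‖(z : ℂ)‖) (g := fun _ ↦ (1 : ℝ))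
        (by fun_prop) continuous_const
    · exact isOpen_sector hg b
  exists_mem_dom z := by
    by_cases hz : (z : ℂ) = 0
    · refine ⟨none, ?_⟩
      change ‖(z : ℂ)‖ < 1
      simp [hz]
    · obtain ⟨b, hb⟩ := exists_mem_sector (g := g) hz
      exact ⟨some b, hb⟩
  mem_dom_iff i z w h := by
    rcases i with _ | b
    · obtain ⟨t, t', -, rfl, rfl, -⟩ := h.exists_position
      change ‖_‖ < 1 ↔ ‖_‖ < 1
      rw [norm_boundaryPoint, norm_boundaryPoint]
    · exact h.mem_sector_iff hg b
  label := chartLabel g A B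
  eventually_label_eq i z hz := by
    rcases i with _ | b
    · exact .of_forall fun _ ↦ rfl
    · filter_upwards [eventually_floor_position hg hz] with w hw
      obtain ⟨k, hk⟩ := hw
      rw [chartLabel, chartLabel, hk, periodicLabel_add]
  exists_label_eq z w h := by
    cases h with
    | a j s => exact ⟨A j, chartLabel_glue_a hg A B j s⟩
    | b j s => exact ⟨B j, chartLabel_glue_b hg hAB j s⟩

end SurfaceModel

end Labels

/-! ### The fundamental group of the glued polygon -/

section FundamentalGroup

open Topology unitInterval

namespace SurfaceModel

variable {g : ℕ}

instance : SimplyConnectedSpace Disc :=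
  have : ContractibleSpace Disc :=
    (convex_closedBall (0 : ℂ) 1).contractibleSpace ⟨0, by simp⟩
  inferInstance

/-- The center of the disc. -/
def center : Disc := ⟨0, by simp⟩

/-- The loop crossing the side `a j`. -/
noncomputable def loopA (g j : ℕ) : FundamentalGroup (Quot (Glue g)) (Quot.mk _ center) :=
  if h : j < g then crossingLoop (Glue g) center (Quot.sound (Glue.a ⟨j, h⟩ 0)) else 1

/-- The loop crossing the side `b j`. -/
noncomputable def loopB (g j : ℕ) : FundamentalGroup (Quot (Glue g)) (Quot.mk _ center) :=
  if h : j < g then crossingLoop (Glue g) center (Quot.sound (Glue.b ⟨j, h⟩ 0)) else 1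

/-- The path running along the boundary of the polygon. -/
noncomputable def boundaryPath (g : ℕ) (t t' : ℝ) : Path (boundaryPoint g t) (boundaryPoint g t') where
  toFun r := boundaryPoint g ((1 - r) * t + r * t')
  continuous_toFun := continuous_boundaryPoint.comp (by fun_prop)
  source' := by simp
  target' := by simp

/-- The crossing point may be slid along the side, in step with its partner, to the end `s = 0`. -/
theorem crossingLoop_eq_loopA {j : ℕ} (hj : j < g) (s : I) {t t' : ℝ} (ht : t = 4 * j + s)
    (ht' : t' = 4 * j + 3 - s)
    (h : Quot.mk (Glue g) (boundaryPoint g t) = Quot.mk (Glue g) (boundaryPoint g t')) :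
    crossingLoop (Glue g) center h = loopA g j := by
  rw [loopA, dif_pos hj]
  refine (crossingLoop_eq_of_path _ h (boundaryPath g _ t) (boundaryPath g _ t') fun r ↦ ?_).symm
  have := Glue.a (g := g) ⟨j, hj⟩ (r * s)
  convert Quot.sound this using 2
  · change boundaryPoint g _ = _
    congr 1
    rw [ht]
    simp only [Set.Icc.coe_zero, Set.Icc.coe_mul]
    ring
  · change boundaryPoint g _ = _
    congr 1
    rw [ht']
    simp only [Set.Icc.coe_zero, Set.Icc.coe_mul]
    ring

theorem crossingLoop_eq_loopB {j : ℕ} (hj : j < g) (s : I) {t t' : ℝ} (ht : t = 4 * j + 1 + s)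
    (ht' : t' = 4 * j + 4 - s)
    (h : Quot.mk (Glue g) (boundaryPoint g t) = Quot.mk (Glue g) (boundaryPoint g t')) :
    crossingLoop (Glue g) center h = loopB g j := by
  rw [loopB, dif_pos hj]
  refine (crossingLoop_eq_of_path _ h (boundaryPath g _ t) (boundaryPath g _ t') fun r ↦ ?_).symm
  have := Glue.b (g := g) ⟨j, hj⟩ (r * s)
  convert Quot.sound this using 2
  · change boundaryPoint g _ = _
    congr 1
    rw [ht]
    simp only [Set.Icc.coe_zero, Set.Icc.coe_mul]
    ring
  · change boundaryPoint g _ = _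
    congr 1
    rw [ht']
    simp only [Set.Icc.coe_zero, Set.Icc.coe_mul]
    ring

theorem mk_boundaryPoint_a {j : ℕ} (hj : j < g) (s : I) {t t' : ℝ} (ht : t = 4 * j + s)
    (ht' : t' = 4 * j + 3 - s) :
    Quot.mk (Glue g) (boundaryPoint g t) = Quot.mk (Glue g) (boundaryPoint g t') := by
  rw [ht, ht']
  exact Quot.sound (Glue.a ⟨j, hj⟩ s)

theorem mk_boundaryPoint_b {j : ℕ} (hj : j < g) (s : I) {t t' : ℝ} (ht : t = 4 * j + 1 + s)
    (ht' : t' = 4 * j + 4 - s) :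
    Quot.mk (Glue g) (boundaryPoint g t) = Quot.mk (Glue g) (boundaryPoint g t') := by
  rw [ht, ht']
  exact Quot.sound (Glue.b ⟨j, hj⟩ s)

/-- Turning around the vertex from corner `4 * n` one reaches `4 * n + 3`, `4 * n + 2`, `4 * n + 1`
and `4 * n + 4`, crossing `a`, `b` backwards, `a` backwards and `b`. Later crossings multiply on the
left. -/
theorem exists_crossingLoop_eq_surfaceWord : ∀ {n : ℕ}, n ≤ g →
    ∃ h : Quot.mk (Glue g) (boundaryPoint g 0) = Quot.mk (Glue g) (boundaryPoint g (4 * n)),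
      crossingLoop (Glue g) center h = surfaceWord (loopA g) (loopB g) n
  | 0, _ => by
    have h0 : (4 * (0 : ℕ) : ℝ) = 0 := by simp
    rw [h0]
    exact ⟨rfl, crossingLoop_self _⟩
  | n + 1, hn => by
    obtain ⟨h, hh⟩ := exists_crossingLoop_eq_surfaceWord (n := n) (by omega)
    have hn : n < g := hn
    have e₁ : (4 * (n : ℝ)) = 4 * n + (0 : I) := by simp
    have e₂ : (4 * (n : ℝ) + 3) = 4 * n + 3 - (0 : I) := by simp
    have e₃ : (4 * (n : ℝ) + 2) = 4 * n + 1 + (1 : I) := by simp; ring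
    have e₄ : (4 * (n : ℝ) + 3) = 4 * n + 4 - (1 : I) := by simp; ring
    have e₅ : (4 * (n : ℝ) + 1) = 4 * n + (1 : I) := by simp
    have e₆ : (4 * (n : ℝ) + 2) = 4 * n + 3 - (1 : I) := by simp; ring
    have e₇ : (4 * (n : ℝ) + 1) = 4 * n + 1 + (0 : I) := by simp
    have e₈ : (4 * ((n + 1 : ℕ) : ℝ)) = 4 * n + 4 - (0 : I) := by simp; ring
    have h₁ := mk_boundaryPoint_a hn 0 e₁ e₂
    have h₂ := mk_boundaryPoint_b hn 1 e₃ e₄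
    have h₃ := mk_boundaryPoint_a hn 1 e₅ e₆
    have h₄ := mk_boundaryPoint_b hn 0 e₇ e₈
    have k₁ := h.trans h₁
    have k₂ := k₁.trans h₂.symm
    have k₃ := k₂.trans h₃.symm
    refine ⟨k₃.trans h₄, ?_⟩
    rw [← crossingLoop_mul k₃ h₄, ← crossingLoop_mul k₂ h₃.symm, ← crossingLoop_mul k₁ h₂.symm,
      ← crossingLoop_mul h h₁, crossingLoop_symm h₃, crossingLoop_symm h₂, hh,
      crossingLoop_eq_loopA hn 0 e₁ e₂, crossingLoop_eq_loopB hn 1 e₃ e₄,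
      crossingLoop_eq_loopA hn 1 e₅ e₆, crossingLoop_eq_loopB hn 0 e₇ e₈, surfaceWord]
    group

theorem surfaceWord_loop (hg : 0 < g) : surfaceWord (loopA g) (loopB g) g = 1 := by
  obtain ⟨h, hh⟩ := exists_crossingLoop_eq_surfaceWord (le_refl g)
  rw [← hh]
  have key : ∀ {z w : Disc} (h : Quot.mk (Glue g) z = Quot.mk (Glue g) w), z = w →
      crossingLoop (Glue g) center h = 1 := by
    rintro z _ h rfl
    exact crossingLoop_self h
  -- After `g` handles the corner `4 * g` is the point at position `0`, and crossing from a point to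
  -- itself is trivial.
  exact key h ((boundaryPoint_eq_iff hg).2 ⟨-1, by push_cast; ring⟩)

theorem admitsFaithfulHighlyTransitiveAction (hg : 1 < g) :
    AdmitsFaithfulHighlyTransitiveAction
      (FundamentalGroup (Quot (Glue g)) (Quot.mk _ center)) := by
  have hg₀ : 0 < g := by omega
  refine admitsFaithfulHighlyTransitiveAction_of_surfaceWord g hg (loopA g) (loopB g) ?_
    (surfaceWord_loop hg₀) ?_
  · intro K hK
    refine eq_top_of_crossingLoop_mem (exists_gluingContraction hg₀) fun z w h ↦ ?_
    cases h with
    | a j s =>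
      rw [crossingLoop_eq_loopA j.2 s rfl rfl]
      exact (hK j j.2).1
    | b j s =>
      rw [crossingLoop_eq_loopB j.2 s rfl rfl]
      exact (hK j j.2).2
  · intro X A B hAB
    obtain ⟨ρ, hρ⟩ := (polygonAtlas hg₀ hAB).exists_fundamentalGroup_hom center
    refine ⟨ρ, fun i hi ↦ ⟨?_, ?_⟩⟩
    · rw [loopA, dif_pos hi]
      exact hρ _ _ _ _ (chartLabel_glue_a hg₀ A B ⟨i, hi⟩ 0)
    · rw [loopB, dif_pos hi]
      exact hρ _ _ _ _ (chartLabel_glue_b hg₀ hAB ⟨i, hi⟩ 0)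

end SurfaceModel

theorem AdmitsFaithfulHighlyTransitiveAction.of_mulEquiv {G H : Type*} [Group G] [Group H]
    (e : H ≃* G) (h : AdmitsFaithfulHighlyTransitiveAction G) :
    AdmitsFaithfulHighlyTransitiveAction H := by
  obtain ⟨X, hc, hi, act, hf, ht⟩ := h
  let act' : MulAction H X := MulAction.compHom X (e : H →* G)
  refine ⟨X, hc, hi, act', ⟨fun {a b} hab ↦ e.injective (hf.eq_of_smul_eq_smul hab)⟩,
    fun n hn ↦ ⟨fun p q ↦ ?_⟩⟩
  obtain ⟨γ, hγ⟩ := (ht n hn).exists_smul_eq p q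
  refine ⟨e.symm γ, ?_⟩
  rw [← hγ]
  refine DFunLike.ext _ _ fun i ↦ ?_
  change e (e.symm γ) • p i = γ • p i
  rw [e.apply_symm_apply]

/-- A homeomorphism induces an isomorphism of fundamental groups. -/
noncomputable def Homeomorph.fundamentalGroupMulEquiv {S T : Type*} [TopologicalSpace S]
    [TopologicalSpace T] (e : S ≃ₜ T) (x : S) :
    FundamentalGroup S x ≃* FundamentalGroup T (e x) :=
  (FundamentalGroupoidFunctor.equivOfHomotopyEquiv
    e.toHomotopyEquiv).fullyFaithfulFunctor.mulEquivEnd (FundamentalGroupoid.mk x)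

end FundamentalGroup

theorem mainTheorem5 (g : ℕ) (hg : 1 < g) (S : Type*) [TopologicalSpace S]
    (hS : IsClosedOrientableSurfaceOfGenus g S) (x : S) :
    AdmitsFaithfulHighlyTransitiveAction (FundamentalGroup S x) := by
  obtain ⟨e⟩ := hS
  have : PathConnectedSpace (OrientableSurface g) :=
    Function.Surjective.pathConnectedSpace (f := (Quot.mk (SurfaceModel.Glue g) : _ → _))
      Quot.mk_surjective continuous_quot_mk
  exact (SurfaceModel.admitsFaithfulHighlyTransitiveAction hg).of_mulEquiv
    ((e.fundamentalGroupMulEquiv x).trans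
      (FundamentalGroup.fundamentalGroupMulEquivOfPathConnected _ _))
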